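/- Let $X$ be an arbitrary measure space with measure $\lambda$, and let $E$ be a reflexive complex Banach space. Write $\mathcal B(E,F)$ for the bounded linear maps from $E$ to $F$, $\mathcal B(E)=\mathcal B(E,E)$, $E^*$ for the dual of $E$, $\widehat\otimes$ for the (completed) projective tensor product, and $L^p(X,E)$ for the Bochner $L^p$-space. Let $$\Lambda: L^2(X,E^*)\widehat\otimes L^2(X,E)\to L^1(X,E^*\widehat\otimes E)$$ be the bounded linear map with $\Lambda(F\otimes G)(t)=F(t)\otimes G(t)$ for almost every $t$; thus $\Lambda\big((f\otimes\mu)\otimes(g\otimes x)\big)=fg\otimes(\mu\otimes x)$ for $f,g\in L^2(X)$, $\mu\in E^*$, $x\in E$. An operator $\pi\in\mathcal B(L^1(X),\mathcal B(E))$ is regarded as a functional on $L^1(X,E^*\widehat\otimes E)=L^1(X)\widehat\otimes E^*\widehat\otimes E$ by $\langle\pi,f\otimes\mu\otimes x\rangle=\mu(\pi(f)x)$, and an operator $W\in\mathcal B(L^2(X,E))$ is regarded as a functional on $L^2(X,E^*)\widehat\otimes L^2(X,E)$ by the bilinear pairing $\langle W,F\otimes G\rangle=\int_X F(t)\big((WG)(t)\big)\,d\lambda(t)$;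 the weak$^*$-topology of $\mathcal B(L^2(X,E))$ is the one given by this pairing. Let $L^\infty(X)\otimes\mathcal B(E)\subseteq\mathcal B(L^2(X,E))$ be the linear span of the operators $F\otimes S$, $((F\otimes S)G)(t)=F(t)\,S(G(t))$, with $F\in L^\infty(X)$ and $S\in\mathcal B(E)$, and let $L^\infty(X)\overline\otimes\mathcal B(E)$ be its weak$^*$-closure in $\mathcal B(L^2(X,E))$. Then: 1. $\Lambda$ is a metric surjection, that is, it maps the open unit ball of $L^2(X,E^*)\widehat\otimes L^2(X,E)$ onto the open unit ball of $L^1(X,E^*\widehat\otimes E)$. 2. The adjoint of $\Lambda$ is a linear isometry $\Lambda^*:\mathcal B(L^1(X),\mathcal B(E))\to\mathcal B(L^2(X,E))$: for each $\pi$, the operator $\Lambda^*(\pi)$ is the unique $W\in\mathcal B(L^2(X,E))$ with $\langle W,\tau\rangle=\langle\pi,\Lambda(\tau)\rangle$ for all $\tau\in L^2(X,E^*)\widehat\otimes L^2(X,E)$, and $\|\Lambda^*(\pi)\|=\|\pi\|$. 3. The image of $\Lambda^*$ is exactly $L^\infty(X)\overline\otimes\mathcal B(E)$. -/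

import Mathlib

open MeasureTheory Topology
open scoped ENNReal TensorProduct

set_option linter.unusedSectionVars false

noncomputable section

/-! Projective tensor product of two complex normed spaces. -/

/-- The algebraic tensor product `E ⊗ F`; a copy that carries the projective tensor norm. -/
def ProjAlg (E F : Type*) [NormedAddCommGroup E] [NormedSpace ℂ E]
    [NormedAddCommGroup F] [NormedSpace ℂ F] : Type _ := E ⊗[ℂ] F

namespace ProjAlg

variable {E F : Type*} [NormedAddCommGroup E] [NormedSpace ℂ E]
  [NormedAddCommGroup F] [NormedSpace ℂ F]

instance instAddCommGroup : AddCommGroup (ProjAlg E F) :=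
  inferInstanceAs (AddCommGroup (E ⊗[ℂ] F))

instance instModule : Module ℂ (ProjAlg E F) := inferInstanceAs (Module ℂ (E ⊗[ℂ] F))

/-- The elementary tensor `x ⊗ y`, as a bilinear map. -/
def mk : E →ₗ[ℂ] F →ₗ[ℂ] ProjAlg E F := TensorProduct.mk ℂ E F

/-- The representations `τ = ∑ x_k ⊗ y_k` of a tensor. -/
abbrev Rep (τ : ProjAlg E F) : Type _ :=
  {l : List (E × F) // (l.map fun q => mk q.1 q.2).sum = τ}

/-- `∑ ‖x_k‖ ‖y_k‖`. -/
def cost (l : List (E × F)) : ℝ := (l.map fun q => ‖q.1‖ * ‖q.2‖).sum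

theorem cost_nonneg (l : List (E × F)) : 0 ≤ cost l := by
  refine List.sum_nonneg fun a ha => ?_
  obtain ⟨q, _, rfl⟩ := List.mem_map.1 ha
  positivity

/-- The projective tensor norm. -/
def projNorm (τ : ProjAlg E F) : ℝ := ⨅ l : Rep τ, cost l.1

theorem bddBelow_cost (τ : ProjAlg E F) : BddBelow (Set.range fun l : Rep τ => cost l.1) :=
  ⟨0, by rintro _ ⟨l, rfl⟩; exact cost_nonneg _⟩

instance instNonemptyRep (τ : ProjAlg E F) : Nonempty (Rep τ) := by
  induction τ using TensorProduct.induction_on with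
  | zero => exact ⟨⟨[], rfl⟩⟩
  | tmul x y => exact ⟨⟨[(x, y)], by simp; rfl⟩⟩
  | add a b ha hb =>
    obtain ⟨l⟩ := ha
    obtain ⟨m⟩ := hb
    exact ⟨⟨l.1 ++ m.1, by rw [List.map_append, List.sum_append, l.2, m.2]; rfl⟩⟩

theorem projNorm_zero : projNorm (0 : ProjAlg E F) = 0 :=
  le_antisymm (ciInf_le_of_le (bddBelow_cost _) ⟨[], rfl⟩ (by simp [cost]))
    (le_ciInf fun l => cost_nonneg l.1)

theorem projNorm_add_le (σ τ : ProjAlg E F) : projNorm (σ + τ) ≤ projNorm σ + projNorm τ :=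
  le_ciInf_add_ciInf fun l m => ciInf_le_of_le (bddBelow_cost _)
    ⟨l.1 ++ m.1, by rw [List.map_append, List.sum_append, l.2, m.2]⟩ (by simp [cost])

theorem projNorm_smul_le (c : ℂ) (τ : ProjAlg E F) : projNorm (c • τ) ≤ ‖c‖ * projNorm τ := by
  simp only [projNorm, Real.mul_iInf_of_nonneg (norm_nonneg _)]
  refine le_ciInf fun l => ciInf_le_of_le (bddBelow_cost _)
    ⟨l.1.map fun q => (c • q.1, q.2), ?_⟩ ?_
  · have h : c • (l.1.map fun q => mk q.1 q.2).sum = c • τ := congrArg (c • ·) l.2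
    rw [← h, List.smul_sum]
    simp [Function.comp_def]
  · simp [cost, Function.comp_def, norm_smul, mul_assoc, List.sum_map_mul_left]

/-- The projective tensor norm, as a seminorm. -/
def projSeminorm : Seminorm ℂ (ProjAlg E F) :=
  Seminorm.ofSMulLE projNorm projNorm_zero projNorm_add_le projNorm_smul_le

instance instSeminormed : SeminormedAddCommGroup (ProjAlg E F) :=
  AddGroupSeminorm.toSeminormedAddCommGroup projSeminorm.toAddGroupSeminorm

theorem norm_def (τ : ProjAlg E F) : ‖τ‖ = ⨅ l : Rep τ, cost l.1 := rfl

instance instNormedSpace : NormedSpace ℂ (ProjAlg E F) := ⟨projNorm_smul_le⟩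

theorem norm_mk_le (x : E) (y : F) : ‖mk x y‖ ≤ ‖x‖ * ‖y‖ :=
  ciInf_le_of_le (bddBelow_cost _) ⟨[(x, y)], by simp⟩ (by simp [cost])

variable {G : Type*} [NormedAddCommGroup G] [NormedSpace ℂ G]

/-- The linear map on the algebraic tensor product given by a bounded bilinear map. -/
def liftₗ (B : E →L[ℂ] F →L[ℂ] G) : ProjAlg E F →ₗ[ℂ] G :=
  TensorProduct.lift (LinearMap.mk₂ ℂ (fun x y => B x y) (by simp) (by simp) (by simp) (by simp))

theorem liftₗ_mk (B : E →L[ℂ] F →L[ℂ] G) (x : E) (y : F) : liftₗ B (mk x y) = B x y :=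
  TensorProduct.lift.tmul x y

theorem norm_liftₗ_le (B : E →L[ℂ] F →L[ℂ] G) (τ : ProjAlg E F) :
    ‖liftₗ B τ‖ ≤ ‖B‖ * ‖τ‖ := by
  rw [norm_def, Real.mul_iInf_of_nonneg (norm_nonneg B)]
  refine le_ciInf fun ⟨l, hl⟩ => ?_
  subst hl
  dsimp only
  induction l with
  | nil => simp [cost]
  | cons q l ih =>
    have h : ‖B q.1 q.2‖ ≤ ‖B‖ * (‖q.1‖ * ‖q.2‖) := by
      rw [← mul_assoc]; exact B.le_opNorm₂ q.1 q.2
    simp only [List.map_cons, List.sum_cons, map_add, liftₗ_mk, cost, mul_add] at ih ⊢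
    exact (norm_add_le _ _).trans (add_le_add h (ih ⟨l, rfl⟩))

/-- The bounded linear map on the algebraic tensor product given by a bounded bilinear map. -/
def liftL (B : E →L[ℂ] F →L[ℂ] G) : ProjAlg E F →L[ℂ] G :=
  (liftₗ B).mkContinuous ‖B‖ (norm_liftₗ_le B)

end ProjAlg

/-- The projective tensor product: the completion of `E ⊗ F` in the projective tensor norm. -/
abbrev ProjTensor (E F : Type*) [NormedAddCommGroup E] [NormedSpace ℂ E]
    [NormedAddCommGroup F] [NormedSpace ℂ F] : Type _ :=
  UniformSpace.Completion (ProjAlg E F)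

namespace ProjTensor

variable {E F : Type*} [NormedAddCommGroup E] [NormedSpace ℂ E]
  [NormedAddCommGroup F] [NormedSpace ℂ F]

/-- The bounded bilinear map `(x, y) ↦ x ⊗ y`. -/
def tmulL : E →L[ℂ] F →L[ℂ] ProjTensor E F :=
  LinearMap.mkContinuous₂
    (ProjAlg.mk.compr₂ (UniformSpace.Completion.toComplL (𝕜 := ℂ) (E := ProjAlg E F)).toLinearMap)
    1 (fun x y => by
      have h : ‖((ProjAlg.mk x y : ProjAlg E F) : ProjTensor E F)‖ ≤ ‖x‖ * ‖y‖ := by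
        rw [UniformSpace.Completion.norm_coe]; exact ProjAlg.norm_mk_le x y
      simpa using h)

theorem tmulL_apply (x : E) (y : F) :
    tmulL x y = ((ProjAlg.mk x y : ProjAlg E F) : ProjTensor E F) := rfl

variable {G : Type*} [NormedAddCommGroup G] [NormedSpace ℂ G] [CompleteSpace G]

/-- The bounded linear map on the projective tensor product induced by a bounded bilinear map. -/
def lift (B : E →L[ℂ] F →L[ℂ] G) : ProjTensor E F →L[ℂ] G :=
  (ProjAlg.liftL B).extend (UniformSpace.Completion.toComplL (𝕜 := ℂ) (E := ProjAlg E F))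

theorem lift_coe (B : E →L[ℂ] F →L[ℂ] G) (τ : ProjAlg E F) :
    lift B (τ : ProjTensor E F) = ProjAlg.liftₗ B τ :=
  ContinuousLinearMap.extend_eq (ProjAlg.liftL B)
    (e := UniformSpace.Completion.toComplL (𝕜 := ℂ) (E := ProjAlg E F))
    UniformSpace.Completion.denseRange_coe
    (UniformSpace.Completion.isUniformInducing_coe _) τ

theorem lift_tmul (B : E →L[ℂ] F →L[ℂ] G) (x : E) (y : F) : lift B (tmulL x y) = B x y := by
  rw [tmulL_apply, lift_coe, ProjAlg.liftₗ_mk]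

theorem norm_lift_apply_le (B : E →L[ℂ] F →L[ℂ] G) (τ : ProjTensor E F) :
    ‖lift B τ‖ ≤ ‖B‖ * ‖τ‖ := by
  induction τ using UniformSpace.Completion.induction_on with
  | hp => exact isClosed_le (by fun_prop) (by fun_prop)
  | ih a =>
    rw [lift_coe, UniformSpace.Completion.norm_coe]
    exact ProjAlg.norm_liftₗ_le B a

theorem ext_tmul {φ ψ : ProjTensor E F →L[ℂ] G} (h : ∀ x y, φ (tmulL x y) = ψ (tmulL x y)) :
    φ = ψ := by
  ext τ
  induction τ using UniformSpace.Completion.induction_on with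
  | hp => exact isClosed_eq (by fun_prop) (by fun_prop)
  | ih a =>
    induction a using TensorProduct.induction_on with
    | zero =>
      exact (map_zero φ).trans (map_zero ψ).symm
    | tmul x y => exact h x y
    | add a b ha hb =>
      have e : (((show ProjAlg E F from a) + (show ProjAlg E F from b) : ProjAlg E F) :
        ProjTensor E F) = ((show ProjAlg E F from a : ProjAlg E F) : ProjTensor E F)
          + ((show ProjAlg E F from b : ProjAlg E F) : ProjTensor E F) :=
        UniformSpace.Completion.coe_add _ _
      exact (congrArg φ e).trans (((map_add φ _ _).trans (congrArg₂ (· + ·) ha hb)).trans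
        ((map_add ψ _ _).symm.trans (congrArg ψ e).symm))

end ProjTensor

/-! The trace duality between bounded operators and the projective tensor product. -/

section Trace

variable {E : Type*} [NormedAddCommGroup E] [NormedSpace ℂ E]

/-- The functional on `E^* ⊗̂ E` given by `S ∈ B(E)`: `⟨S, φ ⊗ x⟩ = φ (S x)`. -/
def tracePairing (S : E →L[ℂ] E) : ProjTensor (StrongDual ℂ E) E →L[ℂ] ℂ :=
  ProjTensor.lift
    ((ContinuousLinearMap.compL ℂ E E ℂ).flip S)

theorem tracePairing_tmul (S : E →L[ℂ] E) (φ : StrongDual ℂ E) (x : E) :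
    tracePairing S (ProjTensor.tmulL φ x) = φ (S x) := by
  simp [tracePairing, ProjTensor.lift_tmul]

theorem tracePairing_add (S T : E →L[ℂ] E) :
    tracePairing (S + T) = tracePairing S + tracePairing T :=
  ProjTensor.ext_tmul fun φ x => by simp [tracePairing_tmul]

theorem norm_tracePairing_le (S : E →L[ℂ] E) : ‖tracePairing S‖ ≤ ‖S‖ := by
  refine ContinuousLinearMap.opNorm_le_bound _ (norm_nonneg _) fun τ => ?_
  refine (ProjTensor.norm_lift_apply_le _ τ).trans ?_
  refine mul_le_mul_of_nonneg_right ?_ (norm_nonneg _)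
  refine ContinuousLinearMap.opNorm_le_bound _ (norm_nonneg _) fun φ => ?_
  rw [mul_comm]
  exact φ.opNorm_comp_le S

end Trace

section Main

variable {X : Type*} [MeasurableSpace X] (μ : Measure X)
variable {E : Type*} [NormedAddCommGroup E] [NormedSpace ℂ E]

variable (E) in
/-- The map `Λ : L²(X, E^*) ⊗̂ L²(X, E) → L¹(X, E^* ⊗̂ E)`, given by
`Λ (F ⊗ G) (t) = F t ⊗ G t`. -/
def LambdaMap : ProjTensor (Lp (StrongDual ℂ E) 2 μ) (Lp E 2 μ) →L[ℂ]
    Lp (ProjTensor (StrongDual ℂ E) E) 1 μ :=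
  ProjTensor.lift
    ((ProjTensor.tmulL (E := StrongDual ℂ E) (F := E)).holderL μ 2 2 1)

theorem LambdaMap_tmul (F : Lp (StrongDual ℂ E) 2 μ) (G : Lp E 2 μ) :
    LambdaMap μ E (ProjTensor.tmulL F G) =ᵐ[μ] fun t => ProjTensor.tmulL (F t) (G t) := by
  rw [LambdaMap, ProjTensor.lift_tmul]
  exact ContinuousLinearMap.coeFn_holder _ F G

variable {μ}

open Classical in
/-- The set function `A ↦ ⟨π(χ_A), ·⟩ ∈ (E^* ⊗̂ E)^*`, for `A` of finite measure. -/
def l1SetFun (π : Lp ℂ 1 μ →L[ℂ] (E →L[ℂ] E)) (A : Set X) :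
    ProjTensor (StrongDual ℂ E) E →L[ℝ] ℂ :=
  if h : MeasurableSet A ∧ μ A ≠ ∞ then
    (tracePairing (π (indicatorConstLp 1 h.1 h.2 1))).restrictScalars ℝ
  else 0

theorem l1SetFun_smul (π : Lp ℂ 1 μ →L[ℂ] (E →L[ℂ] E)) (c : ℂ) (A : Set X)
    (τ : ProjTensor (StrongDual ℂ E) E) :
    l1SetFun π A (c • τ) = c • l1SetFun π A τ := by
  unfold l1SetFun
  split_ifs <;> simp

theorem l1SetFun_dominated (π : Lp ℂ 1 μ →L[ℂ] (E →L[ℂ] E)) :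
    DominatedFinMeasAdditive μ (l1SetFun π) ‖π‖ := by
  refine ⟨fun s t hs ht hμs hμt hst => ?_, fun s hs hμs => ?_⟩
  · rw [l1SetFun, l1SetFun, l1SetFun,
      dif_pos ⟨hs.union ht, (measure_union_lt_top hμs.lt_top hμt.lt_top).ne⟩,
      dif_pos ⟨hs, hμs⟩, dif_pos ⟨ht, hμt⟩,
      indicatorConstLp_disjoint_union hs ht hμs hμt hst, map_add, tracePairing_add]
    rfl
  · rw [l1SetFun, dif_pos ⟨hs, hμs.ne⟩, ContinuousLinearMap.norm_restrictScalars]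
    refine (norm_tracePairing_le _).trans ((π.le_opNorm _).trans ?_)
    rw [norm_indicatorConstLp one_ne_zero ENNReal.one_ne_top]
    simp

/-- The functional on `L¹(X, E^* ⊗̂ E) = L¹(X) ⊗̂ E^* ⊗̂ E` given by `π ∈ B(L¹(X), B(E))`:
`⟨π, f ⊗ φ ⊗ x⟩ = φ (π(f) x)`. -/
def l1Pairing (π : Lp ℂ 1 μ →L[ℂ] (E →L[ℂ] E)) :
    Lp (ProjTensor (StrongDual ℂ E) E) 1 μ →L[ℂ] ℂ :=
  L1.setToL1' ℂ (l1SetFun_dominated π) (l1SetFun_smul π)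

theorem l1Pairing_indicator (π : Lp ℂ 1 μ →L[ℂ] (E →L[ℂ] E)) {A : Set X}
    (hA : MeasurableSet A) (hμA : μ A ≠ ∞) (φ : StrongDual ℂ E) (x : E) :
    l1Pairing π (indicatorConstLp 1 hA hμA (ProjTensor.tmulL φ x)) =
      φ (π (indicatorConstLp 1 hA hμA 1) x) := by
  rw [l1Pairing, ← L1.setToL1_eq_setToL1', L1.setToL1_indicatorConstLp, l1SetFun,
    dif_pos ⟨hA, hμA⟩]
  exact tracePairing_tmul _ _ _

/-- The functional on `L²(X, E^*) ⊗̂ L²(X, E)` given by `W ∈ B(L²(X, E))`: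
`⟨W, F ⊗ G⟩ = ∫ (F t) ((W G) t) dμ(t)`. -/
def l2Pairing (W : Lp E 2 μ →L[ℂ] Lp E 2 μ) :
    ProjTensor (Lp (StrongDual ℂ E) 2 μ) (Lp E 2 μ) →L[ℂ] ℂ :=
  ProjTensor.lift
    (((ContinuousLinearMap.compL ℂ (Lp E 2 μ) (Lp E 2 μ) ℂ).flip W).comp
      ((ContinuousLinearMap.id ℂ (StrongDual ℂ E)).lpPairing μ 2 2))

theorem l2Pairing_tmul (W : Lp E 2 μ →L[ℂ] Lp E 2 μ) (F : Lp (StrongDual ℂ E) 2 μ)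
    (G : Lp E 2 μ) : l2Pairing W (ProjTensor.tmulL F G) = ∫ t, F t (W G t) ∂μ := by
  rw [l2Pairing, ProjTensor.lift_tmul]
  simp [ContinuousLinearMap.lpPairing_eq_integral]

variable (μ E) in
/-- The weak-* topology on `B(L²(X, E))` as the dual of `L²(X, E^*) ⊗̂ L²(X, E)`: the coarsest
topology for which every `W ↦ ⟨W, τ⟩` is continuous. -/
abbrev weakStarTopology : TopologicalSpace (Lp E 2 μ →L[ℂ] Lp E 2 μ) :=
  TopologicalSpace.induced
    (fun W (τ : ProjTensor (Lp (StrongDual ℂ E) 2 μ) (Lp E 2 μ)) => l2Pairing W τ)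
    Pi.topologicalSpace

/-- The operator `F ⊗ S` on `L²(X, E)`: `((F ⊗ S) G) t = F t • S (G t)`. -/
def mulTensor (F : Lp ℂ ∞ μ) (S : E →L[ℂ] E) : Lp E 2 μ →L[ℂ] Lp E 2 μ :=
  ((ContinuousLinearMap.lsmul ℂ ℂ : ℂ →L[ℂ] E →L[ℂ] E).holderL μ ∞ 2 2 F).comp
    (S.compLpL 2 μ)

theorem mulTensor_apply (F : Lp ℂ ∞ μ) (S : E →L[ℂ] E) (G : Lp E 2 μ) :
    mulTensor F S G =ᵐ[μ] fun t => F t • S (G t) := by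
  have h1 : mulTensor F S G =ᵐ[μ] fun t => F t • (S.compLp G) t :=
    ContinuousLinearMap.coeFn_holder
      (ContinuousLinearMap.lsmul ℂ ℂ : ℂ →L[ℂ] E →L[ℂ] E) F (S.compLp G)
  filter_upwards [h1, S.coeFn_compLp G] with t h2 h3
  rw [h2, h3]

variable (μ E) in
/-- `L^∞(X) ⊗ B(E)`, inside `B(L²(X, E))`. -/
def algTensor : Submodule ℂ (Lp E 2 μ →L[ℂ] Lp E 2 μ) :=
  Submodule.span ℂ {W | ∃ (F : Lp ℂ ∞ μ) (S : E →L[ℂ] E), W = mulTensor F S}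

variable (μ E) in
/-- `L^∞(X) ⊗̄ B(E)`: the weak-* closure of `L^∞(X) ⊗ B(E)` in `B(L²(X, E))`. -/
def vnTensor : Set (Lp E 2 μ →L[ℂ] Lp E 2 μ) :=
  closure[weakStarTopology μ E] (algTensor μ E : Set (Lp E 2 μ →L[ℂ] Lp E 2 μ))

end Main

end

/-! Λ is a metric surjection for every `E`. The function χ_A (φ ⊗ x) is the product of χ_A φ and χ_A
x, whose L²-norms multiply to μ(A)‖φ‖‖x‖, and L¹-norms add over disjoint supports. So simple
functions have approximate preimages of almost the same norm (`exists_norm_LambdaMap_sub_lt`), and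
successive approximation makes them exact (`exists_LambdaMap_eq`). Composition with Λ therefore
preserves norms of functionals. Both pairings are isometric (`norm_l1Pairing`, `norm_l2Pairing`), so
the adjoint is isometric once its values are known to be operators.

That last point uses reflexivity: ⟨π, Λ(· ⊗ G)⟩ is a priori only a functional on L²(X, E^*). For G =
χ_A x it is integration against a density of B ↦ π(χ_{A ∩ B}) x, which exists by the Radon–Nikodym
property (`hasBoundedDensity_of_reflexive`). Such G span a dense subspace and L²(X, E) is
isometrically embedded, hence closed, in the dual of L²(X, E^*), so all G follow. Only sets of
finite measure occur, so μ may be arbitrary.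

For the Radon–Nikodym property in a separable space, a norming sequence of functionals gives scalar
densities, and Helly's theorem assembles them into vectors. The general case reduces to this one
because the set function has totally bounded range.

For the image: ⟨F ⊗ S, τ⟩ = ∫ F ⟨S, Λτ⟩, so the preannihilator of L^∞(X) ⊗ B(E) is ker Λ, and its
weak-* closure consists of the W that kill ker Λ (`mem_vnTensor_iff`). Such a W factors through Λ,
and the resulting functional on L¹(X, E^* ⊗̂ E) comes from some π because (E^* ⊗̂ E)^* = B(E) for
reflexive `E`. -/

noncomputable section

/-! Reflexive spaces. -/

section Reflexive

variable {E : Type*} [NormedAddCommGroup E] [NormedSpace ℂ E]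

/-- A functional vanishing on a closed subspace separates it from a given point outside. -/
theorem Submodule.exists_dual_eq_zero_of_notMem {p : Submodule ℂ E} (hp : IsClosed (p : Set E))
    {x : E} (hx : x ∉ p) : ∃ φ : StrongDual ℂ E, (∀ y ∈ p, φ y = 0) ∧ φ x ≠ 0 := by
  have hx' : ‖p.mkQ x‖ ≠ 0 := by
    intro h
    have h1 : x ∈ closure (p : Set E) := 
      (QuotientAddGroup.norm_mk_eq_zero_iff_mem_closure (S := p.toAddSubgroup)).1 h
    rw [hp.closure_eq] at h1
    exact hx h1
  obtain ⟨g, -, hg⟩ := exists_dual_vector ℂ (p.mkQ x) hx'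
  refine ⟨g.comp p.mkQL, fun y hy => ?_, ?_⟩
  · have : p.mkQ y = 0 := by simpa using hy
    change g (p.mkQ y) = 0
    rw [this, map_zero]
  · change g (p.mkQ x) ≠ 0
    rw [hg]
    exact Complex.ofReal_ne_zero.2 hx'

/-- A closed subspace of a reflexive space is reflexive. -/
theorem Submodule.surjective_inclusionInDoubleDual
    (hE : Function.Surjective (NormedSpace.inclusionInDoubleDual ℂ E)) {p : Submodule ℂ E}
    (hp : IsClosed (p : Set E)) :
    Function.Surjective (NormedSpace.inclusionInDoubleDual ℂ p) := by
  intro Ψ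
  -- Restriction of functionals from `E` to `p` turns `Ψ` into an element of the bidual of `E`.
  obtain ⟨x, hx⟩ := hE (Ψ.comp ((ContinuousLinearMap.compL ℂ p E ℂ).flip p.subtypeL))
  have hx' : ∀ φ : StrongDual ℂ E, φ x = Ψ (φ.comp p.subtypeL) := fun φ => by
    rw [← NormedSpace.dual_def ℂ E x φ, hx]; rfl
  have hxp : x ∈ p := by
    by_contra h
    obtain ⟨φ, hφ, hφx⟩ := p.exists_dual_eq_zero_of_notMem hp h
    refine hφx ?_
    have : φ.comp p.subtypeL = 0 := by ext y; exact hφ y y.2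
    rw [hx', this, map_zero]
  refine ⟨⟨x, hxp⟩, ?_⟩
  ext ψ
  obtain ⟨φ, hφ, -⟩ := exists_extension_norm_eq p ψ
  have h1 : φ.comp p.subtypeL = ψ := by ext y; exact hφ y
  rw [NormedSpace.dual_def, ← h1, ← hx']
  rfl

/-- Helly's theorem in a reflexive space. -/
theorem exists_forall_apply_eq
    (hE : Function.Surjective (NormedSpace.inclusionInDoubleDual ℂ E))
    (φ : ℕ → StrongDual ℂ E) (a : ℕ → ℂ) (C : ℝ)
    (h : ∀ (N : ℕ) (c : ℕ → ℂ),
      ‖∑ i ∈ Finset.range N, c i * a i‖ ≤ C * ‖∑ i ∈ Finset.range N, c i • φ i‖) :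
    ∃ x, ∀ n, φ n x = a n := by
  set L := Finsupp.linearCombination ℂ φ with hL
  set α := Finsupp.linearCombination ℂ a with hα
  have hb : ∀ c, ‖α c‖ ≤ C * ‖L c‖ := fun c => by
    obtain ⟨N, hN⟩ := c.support.exists_nat_subset_range
    have h1 : L c = ∑ i ∈ Finset.range N, c i • φ i := by
      rw [hL, Finsupp.linearCombination_apply]
      exact Finsupp.sum_of_support_subset c hN _ (by simp)
    have h2 : α c = ∑ i ∈ Finset.range N, c i * a i := by
      rw [hα, Finsupp.linearCombination_apply]
      exact Finsupp.sum_of_support_subset c hN _ (by simp)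
    rw [h1, h2]
    exact h N c
  have hker : L.ker ≤ α.ker := fun c hc => by
    have h1 : L c = 0 := hc
    have h2 := hb c
    rw [h1, norm_zero, mul_zero] at h2
    exact norm_le_zero_iff.1 h2
  -- The rule ∑ c_i φ_i ↦ ∑ c_i a_i is well defined and bounded by `C` on the span of the φ_i. Its
  -- Hahn–Banach extension lies in the bidual, hence is evaluation at a point.
  let f : L.range →ₗ[ℂ] ℂ := (L.ker.liftQ α hker) ∘ₗ L.quotKerEquivRange.symm.toLinearMap
  have hf : ∀ c, f ⟨L c, c, rfl⟩ = α c := fun c => by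
    simp only [f, LinearMap.comp_apply, LinearEquiv.coe_coe]
    rw [LinearMap.quotKerEquivRange_symm_apply_image L c ⟨c, rfl⟩]
    simp
  obtain ⟨Ψ, hΨ, -⟩ := exists_extension_norm_eq L.range
    (f.mkContinuous C (by rintro ⟨_, c, rfl⟩; rw [hf]; exact hb c))
  obtain ⟨x, hx⟩ := hE Ψ
  refine ⟨x, fun n => ?_⟩
  have h1 : L (Finsupp.single n 1) = φ n := by simp [hL]
  have h2 := hΨ ⟨L (Finsupp.single n 1), _, rfl⟩
  rw [← NormedSpace.dual_def ℂ E x, hx, ← h1]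
  refine h2.trans ?_
  rw [LinearMap.mkContinuous_apply, hf]
  simp [hα]

end Reflexive

/-! Densities of scalar set functions. -/

section Scalar

variable {X : Type*} [MeasurableSpace X] {μ : Measure X}

/-- Real parts of `c * g` can be compared with constants by their set integrals. Countably many `c`
suffice by density, and then `c` may depend on `t`: the conjugate of `g t` gives the norm. -/
theorem ae_norm_le_of_forall_norm_setIntegral_le [IsFiniteMeasure μ] {g : X → ℂ}
    (hg : Integrable g μ) {C : ℝ}
    (h : ∀ A, MeasurableSet A → ‖∫ t in A, g t ∂μ‖ ≤ C * μ.real A) :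
    ∀ᵐ t ∂μ, ‖g t‖ ≤ C := by
  have h1 : ∀ c : ℂ, ∀ᵐ t ∂μ, (c * g t).re ≤ C * ‖c‖ := fun c => by
    have hi : Integrable (fun t => c * g t) μ := hg.const_mul c
    refine ae_le_of_forall_setIntegral_le hi.re (integrable_const _) fun A hA _ => ?_
    have e1 : ∫ t in A, (c * g t).re ∂μ = (c * ∫ t in A, g t ∂μ).re := by
      rw [← integral_const_mul]
      exact (integral_re hi.integrableOn)
    rw [setIntegral_const, smul_eq_mul]
    calc ∫ t in A, (c * g t).re ∂μ = (c * ∫ t in A, g t ∂μ).re := e1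
      _ ≤ ‖c * ∫ t in A, g t ∂μ‖ := Complex.re_le_norm _
      _ = ‖c‖ * ‖∫ t in A, g t ∂μ‖ := norm_mul _ _
      _ ≤ ‖c‖ * (C * μ.real A) := by gcongr; exact h A hA
      _ = _ := by ring
  obtain ⟨D, hDc, hD⟩ := TopologicalSpace.exists_countable_dense ℂ
  filter_upwards [(ae_ball_iff hDc).2 fun c _ => h1 c] with t ht
  have h2 : ∀ c : ℂ, (c * g t).re ≤ C * ‖c‖ := fun c => by
    have hcl : IsClosed {c : ℂ | (c * g t).re ≤ C * ‖c‖} := isClosed_le (by fun_prop) (by fun_prop)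
    exact hcl.closure_subset_iff.2 ht (hD c)
  have h3 := h2 (starRingEnd ℂ (g t))
  rw [Complex.conj_mul', RCLike.norm_conj] at h3
  have h4 : ‖g t‖ ^ 2 ≤ C * ‖g t‖ := by
    rw [← Complex.ofReal_pow, Complex.ofReal_re] at h3
    exact h3
  rcases (norm_nonneg (g t)).eq_or_lt with h5 | h5
  -- `C` is not assumed nonnegative; where `g` vanishes, `c = 1` gives `0 ≤ C`.
  · have h6 := h2 1
    simp only [one_mul, norm_one, mul_one] at h6
    have : g t = 0 := norm_eq_zero.1 h5.symm
    simpa [this] using h6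
  · nlinarith

/-- A set function dominated by a finite measure has a bounded density. -/
theorem exists_density_complex [IsFiniteMeasure μ] {T : Set X → ℂ} {C : ℝ}
    (hT : DominatedFinMeasAdditive μ T C) :
    ∃ g : X → ℂ, Measurable g ∧ Integrable g μ ∧ (∀ᵐ t ∂μ, ‖g t‖ ≤ C) ∧
      ∀ A, MeasurableSet A → ∫ t in A, g t ∂μ = T A := by
  -- Values of `T` become multiplication operators, so that `T` extends to a functional `ℓ` on L¹.
  -- As μ is finite, L² embeds in L¹ and the Riesz representation in L² applies.
  let T' : Set X → ℂ →L[ℝ] ℂ := fun A => ((ContinuousLinearMap.lsmul ℂ ℂ : ℂ →L[ℂ] ℂ →L[ℂ] ℂ)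
    (T A)).restrictScalars ℝ
  have hT'1 : ∀ A z, T' A z = T A * z := fun A z => rfl
  have hT' : DominatedFinMeasAdditive μ T' C := by
    refine ⟨fun s t hs ht hμs hμt hst => ?_, fun s hs hμs => ?_⟩
    · ext
      simp [hT'1, hT.1 s t hs ht hμs hμt hst, add_mul]
    · refine (ContinuousLinearMap.opNorm_le_bound _ (norm_nonneg (T s)) fun z => ?_).trans
        (hT.2 s hs hμs)
      rw [hT'1, norm_mul]
  let ℓ : Lp ℂ 1 μ →L[ℂ] ℂ := L1.setToL1' ℂ hT' (fun c A z => by simp [hT'1]; ring)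
  have hℓ : ∀ {A : Set X} (hA : MeasurableSet A),
      ℓ (indicatorConstLp 1 hA (measure_ne_top μ A) 1) = T A := fun {A} hA => by
    simp only [ℓ]
    rw [← L1.setToL1_eq_setToL1', L1.setToL1_indicatorConstLp, hT'1, mul_one]
  let ι : Lp ℂ 2 μ →L[ℂ] Lp ℂ 1 μ :=
    (ContinuousLinearMap.lsmul ℂ ℂ : ℂ →L[ℂ] ℂ →L[ℂ] ℂ).holderL μ 2 2 1
      (indicatorConstLp 2 MeasurableSet.univ (measure_ne_top μ _) 1)
  have hι : ∀ {A : Set X} (hA : MeasurableSet A),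
      ι (indicatorConstLp 2 hA (measure_ne_top μ A) 1) =
        indicatorConstLp 1 hA (measure_ne_top μ A) 1 := fun {A} hA => by
    refine Lp.ext ?_
    have h1 := ContinuousLinearMap.coeFn_holder (r := 1)
      (ContinuousLinearMap.lsmul ℂ ℂ : ℂ →L[ℂ] ℂ →L[ℂ] ℂ)
      (indicatorConstLp 2 MeasurableSet.univ (measure_ne_top μ _) 1)
      (indicatorConstLp 2 hA (measure_ne_top μ A) 1)
    filter_upwards [h1, indicatorConstLp_coeFn (p := 2) (hs := MeasurableSet.univ)
      (hμs := measure_ne_top μ _) (c := (1 : ℂ)), indicatorConstLp_coeFn (p := 2) (hs := hA)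
      (hμs := measure_ne_top μ _) (c := (1 : ℂ)), indicatorConstLp_coeFn (p := 1) (hs := hA)
      (hμs := measure_ne_top μ _) (c := (1 : ℂ))] with t h1 h2 h3 h4
    refine h1.trans ?_
    rw [h2, h3, h4]
    simp
  -- The inner product is conjugate-linear in its first argument, so the density is the conjugate of
  -- `g₀`.
  let g₀ := (InnerProductSpace.toDual ℂ (Lp ℂ 2 μ)).symm (ℓ.comp ι)
  have hg₀ : ∀ {A : Set X} (hA : MeasurableSet A), starRingEnd ℂ (∫ t in A, g₀ t ∂μ) = T A :=
    fun {A} hA => by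
      rw [← L2.inner_indicatorConstLp_one hA (measure_ne_top μ A), inner_conj_symm,
        InnerProductSpace.toDual_symm_apply, ContinuousLinearMap.comp_apply, hι hA, hℓ hA]
  have hi₀ : Integrable g₀ μ := (Lp.memLp g₀).integrable one_le_two
  have hm : AEMeasurable (fun t => starRingEnd ℂ (g₀ t)) μ :=
    Complex.continuous_conj.measurable.comp_aemeasurable hi₀.aemeasurable
  have hi : Integrable (fun t => starRingEnd ℂ (g₀ t)) μ :=
    ⟨hm.aestronglyMeasurable, by
      refine hi₀.2.congr' (.of_forall fun t => ?_); simp⟩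
  have hg : ∀ A, MeasurableSet A → ∫ t in A, hm.mk _ t ∂μ = T A := fun A hA => by
    rw [← hg₀ hA, ← integral_conj]
    exact integral_congr_ae (ae_restrict_of_ae hm.ae_eq_mk.symm)
  have hi' : Integrable (hm.mk _) μ := hi.congr hm.ae_eq_mk
  exact ⟨hm.mk _, hm.measurable_mk, hi', ae_norm_le_of_forall_norm_setIntegral_le hi'
    (fun A hA => by rw [hg A hA]; exact hT.2 A hA (measure_lt_top μ A)), hg⟩

end Scalar

/-! The Radon–Nikodym property of reflexive spaces. -/

section RadonNikodym

variable {X : Type*} {E : Type*} [NormedAddCommGroup E] [NormedSpace ℂ E]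

/-- The set function `T` has a density with respect to `μ` that is bounded by `C`. -/
def HasBoundedDensity [MeasurableSpace X] (μ : Measure X) (T : Set X → E) (C : ℝ) : Prop :=
  ∃ h : X → E, StronglyMeasurable h ∧ (∀ᵐ t ∂μ, ‖h t‖ ≤ C) ∧
    ∀ A, MeasurableSet A → ∫ t in A, h t ∂μ = T A

variable (E) in
-- Norming functionals at the points of a dense sequence suffice, since each is 1-Lipschitz.
theorem exists_norming_seq [TopologicalSpace.SeparableSpace E] :
    ∃ φ : ℕ → StrongDual ℂ E, (∀ n, ‖φ n‖ ≤ 1) ∧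
      ∀ (y : E) (r : ℝ), ‖y‖ ≤ r ↔ ∀ n, ‖φ n y‖ ≤ r := by
  choose φ hφ hφx using fun n => exists_dual_vector'' ℂ (TopologicalSpace.denseSeq E n)
  have hle : ∀ n y, ‖φ n y‖ ≤ ‖y‖ := fun n y =>
    ((φ n).le_opNorm y).trans (mul_le_of_le_one_left (norm_nonneg _) (hφ n))
  refine ⟨φ, hφ, fun y r => ⟨fun h n => (hle n y).trans h, fun h => ?_⟩⟩
  refine le_of_forall_pos_le_add fun ε hε => ?_
  obtain ⟨n, hn⟩ := (TopologicalSpace.denseRange_denseSeq E).exists_dist_lt y (half_pos hε)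
  set x := TopologicalSpace.denseSeq E n
  rw [dist_eq_norm] at hn
  have h1 : ‖x‖ ≤ ‖φ n y‖ + ‖y - x‖ := by
    have e : φ n x = φ n y - φ n (y - x) := by rw [map_sub]; ring
    calc ‖x‖ = ‖φ n x‖ := by rw [hφx n, RCLike.norm_ofReal, abs_norm]
      _ ≤ ‖φ n y‖ + ‖φ n (y - x)‖ := by rw [e]; exact norm_sub_le _ _
      _ ≤ _ := by gcongr; exact hle n _
  have h2 : ‖y‖ ≤ ‖y - x‖ + ‖x‖ := by simpa using norm_add_le (y - x) x
  linarith [h n]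

theorem measurable_of_closedBall {Y : Type*} [MeasurableSpace X] [PseudoMetricSpace Y]
    [TopologicalSpace.SeparableSpace Y] [MeasurableSpace Y] [BorelSpace Y] {h : X → Y}
    (H : ∀ y r, MeasurableSet (h ⁻¹' Metric.closedBall y r)) : Measurable h := by
  obtain ⟨D, hDc, hD⟩ := TopologicalSpace.exists_countable_dense Y
  refine measurable_of_isOpen fun U hU => ?_
  have e : h ⁻¹' U = ⋃ q ∈ {q : Y × ℕ | q.1 ∈ D ∧ Metric.closedBall q.1 (1 / (q.2 + 1 : ℝ)) ⊆ U},
      h ⁻¹' Metric.closedBall q.1 (1 / (q.2 + 1 : ℝ)) := by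
    ext t
    simp only [Set.mem_preimage, Set.mem_ofPred_eq, Set.mem_iUnion, exists_prop, Prod.exists]
    constructor
    · intro ht
      obtain ⟨ε, hε, hεU⟩ := Metric.isOpen_iff.1 hU _ ht
      obtain ⟨k, hk⟩ := exists_nat_one_div_lt (half_pos hε)
      obtain ⟨y, hyD, hy⟩ := hD.exists_dist_lt (h t) (Nat.one_div_pos_of_nat (α := ℝ) (n := k))
      refine ⟨y, k, ⟨hyD, fun z hz => hεU ?_⟩, hy.le⟩
      rw [Metric.mem_ball]
      rw [Metric.mem_closedBall] at hz
      calc dist z (h t) ≤ dist z y + dist (h t) y := dist_triangle_right _ _ _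
        _ < ε := by linarith
    · rintro ⟨y, k, ⟨-, hsub⟩, hy⟩
      exact hsub hy
  rw [e]
  have hc : (D ×ˢ (Set.univ : Set ℕ)).Countable := hDc.prod Set.countable_univ
  exact MeasurableSet.biUnion (hc.mono fun q hq => Set.mk_mem_prod hq.1 (Set.mem_univ _))
    fun q _ => H _ _

/-- Each φ_n ∘ T has a scalar density g_n. Helly's theorem yields, for almost every t, a vector h(t)
with φ_n(h t) = g_n t for all n. As the φ_n are norming, measurability, bound and integrals of h can
all be read off from the g_n. -/
theorem hasBoundedDensity_of_separableSpace [MeasurableSpace X] {μ : Measure X}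
    [IsFiniteMeasure μ] [CompleteSpace E] [TopologicalSpace.SeparableSpace E]
    (hE : Function.Surjective (NormedSpace.inclusionInDoubleDual ℂ E)) {T : Set X → E} {C : ℝ}
    (hT : DominatedFinMeasAdditive μ T C) : HasBoundedDensity μ T C := by
  classical
  obtain ⟨φ, hφ, hnorm⟩ := exists_norming_seq E
  have hφT : ∀ n, DominatedFinMeasAdditive μ (fun A => φ n (T A)) (‖φ n‖ * C) := fun n => by
    refine ⟨fun s t hs ht hμs hμt hst => ?_, fun s hs hμs => ?_⟩
    · simp [hT.1 s t hs ht hμs hμt hst]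
    · rw [mul_assoc]
      exact ((φ n).le_opNorm _).trans (by gcongr; exact hT.2 s hs hμs)
  choose g hgm hgi _hgb hgA using fun n => exists_density_complex (hφT n)
  -- The hypothesis of Helly's theorem, so far almost everywhere for each fixed `c`; density of `D`
  -- later yields one null set for all `c`.
  have hcomb : ∀ (N : ℕ) (c : ℕ → ℂ), ∀ᵐ t ∂μ,
      ‖∑ i ∈ Finset.range N, c i * g i t‖ ≤ ‖∑ i ∈ Finset.range N, c i • φ i‖ * C := by
    intro N c
    have hi : ∀ i ∈ Finset.range N, Integrable (fun t => c i * g i t) μ := fun i _ =>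
      (hgi i).const_mul _
    refine ae_norm_le_of_forall_norm_setIntegral_le (integrable_finsetSum _ hi) fun A hA => ?_
    have e : ∫ t in A, ∑ i ∈ Finset.range N, c i * g i t ∂μ =
        (∑ i ∈ Finset.range N, c i • φ i) (T A) := by
      rw [integral_finsetSum _ fun i hi' => (hi i hi').integrableOn]
      simp [integral_const_mul, hgA _ A hA]
    rw [e, mul_assoc]
    exact (ContinuousLinearMap.le_opNorm _ _).trans
      (by gcongr; exact hT.2 A hA (measure_lt_top μ A))
  obtain ⟨D, hDc, hD⟩ := TopologicalSpace.exists_countable_dense (ℕ → ℂ)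
  have hgood : ∀ᵐ t ∂μ, ∀ N, ∀ c ∈ D,
      ‖∑ i ∈ Finset.range N, c i * g i t‖ ≤ ‖∑ i ∈ Finset.range N, c i • φ i‖ * C :=
    ae_all_iff.2 fun N => (ae_ball_iff hDc).2 fun c _ => hcomb N c
  obtain ⟨B, hBsub, hBm, hB0⟩ := exists_measurable_superset_of_null (ae_iff.1 hgood)
  have hex : ∀ t, t ∉ B → ∃ x, ∀ n, φ n x = g n t := by
    intro t ht
    have ht' : ∀ N, ∀ c ∈ D,
        ‖∑ i ∈ Finset.range N, c i * g i t‖ ≤ ‖∑ i ∈ Finset.range N, c i • φ i‖ * C := by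
      by_contra h
      exact ht (hBsub h)
    refine exists_forall_apply_eq hE φ (fun n => g n t) C fun N c => ?_
    rw [mul_comm]
    have hcl : IsClosed {c : ℕ → ℂ | ‖∑ i ∈ Finset.range N, c i * g i t‖ ≤
        ‖∑ i ∈ Finset.range N, c i • φ i‖ * C} := isClosed_le (by fun_prop) (by fun_prop)
    exact hcl.closure_subset_iff.2 (ht' N) (hD c)
  choose! h₀ hh₀ using hex
  let h : X → E := fun t => if t ∈ B then 0 else h₀ t
  have hh : ∀ t, t ∉ B → ∀ n, φ n (h t) = g n t := fun t ht => by
    simpa only [h, if_neg ht] using hh₀ t ht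
  have hnB : ∀ᵐ t ∂μ, t ∉ B := measure_eq_zero_iff_ae_notMem.1 hB0
  borelize E
  have hm : Measurable h := by
    refine measurable_of_closedBall fun y r => ?_
    -- Off the null set `B` the norming sequence turns membership in a ball into countably many
    -- conditions on the `g n`.
    have e : h ⁻¹' Metric.closedBall y r = (B ∩ {_t | ‖(0 : E) - y‖ ≤ r}) ∪
        (Bᶜ ∩ ⋂ n, {t | ‖g n t - φ n y‖ ≤ r}) := by
      ext t
      by_cases ht : t ∈ B
      · simp [h, ht]
      · simp only [Set.mem_preimage, Metric.mem_closedBall, dist_eq_norm, hnorm, Set.mem_union,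
          Set.mem_inter_iff, ht, false_and, Set.mem_compl_iff, not_false_eq_true, true_and,
          false_or, Set.mem_iInter, Set.mem_ofPred_eq, map_sub, hh t ht]
    rw [e]
    refine (hBm.inter (MeasurableSet.const _)).union (hBm.compl.inter
      (MeasurableSet.iInter fun n => ?_))
    exact measurableSet_le ((hgm n).sub_const _).norm measurable_const
  have hsm : StronglyMeasurable h := hm.stronglyMeasurable
  have hbd : ∀ᵐ t ∂μ, ‖h t‖ ≤ C := by
    have h1 : ∀ᵐ t ∂μ, ∀ n, ‖φ n (h t)‖ ≤ C := by
      refine ae_all_iff.2 fun n => ?_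
      have h2 : ∀ᵐ t ∂μ, ‖g n t‖ ≤ C := by
        refine ae_norm_le_of_forall_norm_setIntegral_le (hgi n) fun A hA => ?_
        rw [hgA n A hA]
        exact ((φ n).le_opNorm _).trans ((mul_le_of_le_one_left (norm_nonneg _) (hφ n)).trans
          (hT.2 A hA (measure_lt_top μ A)))
      filter_upwards [h2, hnB] with t h2 h3
      rwa [hh t h3]
    filter_upwards [h1] with t h1
    exact (hnorm _ _).2 h1
  have hint : Integrable h μ := .of_bound hsm.aestronglyMeasurable C hbd
  refine ⟨h, hsm, hbd, fun A hA => ?_⟩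
  rw [← sub_eq_zero, ← norm_le_zero_iff, hnorm]
  intro n
  rw [map_sub, ← ContinuousLinearMap.integral_comp_comm _ hint.integrableOn,
    integral_congr_ae (g := g n), hgA n A hA, sub_self, norm_zero]
  filter_upwards [ae_restrict_of_ae hnB] with t ht
  exact hh t ht n

theorem hasBoundedDensity_of_isSeparable [MeasurableSpace X] {μ : Measure X}
    [IsFiniteMeasure μ] [CompleteSpace E]
    (hE : Function.Surjective (NormedSpace.inclusionInDoubleDual ℂ E)) {T : Set X → E} {C : ℝ}
    (hT : DominatedFinMeasAdditive μ T C)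
    (hs : TopologicalSpace.IsSeparable (T '' {A | MeasurableSet A})) :
    HasBoundedDensity μ T C := by
  classical
  set p := (Submodule.span ℂ (T '' {A | MeasurableSet A})).topologicalClosure
  have hpc : IsClosed (p : Set E) := Submodule.isClosed_topologicalClosure _
  have : TopologicalSpace.SeparableSpace p := (hs.span (R := ℂ)).closure.separableSpace
  have : CompleteSpace p := hpc.completeSpace_coe
  have hmem : ∀ A, MeasurableSet A → T A ∈ p := fun A hA =>
    Submodule.le_topologicalClosure _ (Submodule.subset_span ⟨A, hA, rfl⟩)
  let T' : Set X → p := fun A => if h : MeasurableSet A then ⟨T A, hmem A h⟩ else 0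
  have hT'1 : ∀ A, MeasurableSet A → (T' A : E) = T A := fun A hA => by simp [T', hA]
  have hT' : DominatedFinMeasAdditive μ T' C := by
    refine ⟨fun s t hs ht hμs hμt hst => ?_, fun s hs hμs => ?_⟩
    · ext
      rw [hT'1 _ (hs.union ht), Submodule.coe_add, hT'1 _ hs, hT'1 _ ht,
        hT.1 s t hs ht hμs hμt hst]
    · change ‖(T' s : E)‖ ≤ _
      rw [hT'1 s hs]
      exact hT.2 s hs hμs
  obtain ⟨h, hm, hb, hi⟩ := hasBoundedDensity_of_separableSpace
    (Submodule.surjective_inclusionInDoubleDual hE hpc) hT'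
  refine ⟨fun t => h t, p.subtypeL.continuous.comp_stronglyMeasurable hm, hb, fun A hA => ?_⟩
  rw [← hT'1 A hA, ← hi A hA]
  have hint : Integrable h μ := .of_bound hm.aestronglyMeasurable C hb
  exact p.subtypeL.integral_comp_comm hint.integrableOn

theorem MeasureTheory.DominatedFinMeasAdditive.norm_sub_le [MeasurableSpace X] {μ : Measure X}
    [IsFiniteMeasure μ] {T : Set X → E} {C : ℝ} (hT : DominatedFinMeasAdditive μ T C)
    {A B : Set X} (hA : MeasurableSet A) (hB : MeasurableSet B) :
    ‖T A - T B‖ ≤ C * μ.real (symmDiff A B) := by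
  have key : ∀ {A B : Set X}, MeasurableSet A → MeasurableSet B → T A = T (A ∩ B) + T (A \ B) :=
    fun {A B} hA hB => by
      rw [← hT.1 _ _ (hA.inter hB) (hA.diff hB) (measure_ne_top _ _) (measure_ne_top _ _)
        (Set.disjoint_sdiff_inter.symm), Set.inter_union_sdiff]
  have e : T A - T B = T (A \ B) - T (B \ A) := by
    rw [key hA hB, key hB hA, Set.inter_comm B A]; abel
  rw [e, measureReal_symmDiff_eq hA hB, mul_add]
  exact (_root_.norm_sub_le _ _).trans (add_le_add
    (hT.2 _ (hA.diff hB) (measure_lt_top _ _)) (hT.2 _ (hB.diff hA) (measure_lt_top _ _)))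

/-- `T` is Lipschitz for the distance μ(A ∆ B), so a countable dense family of sets has dense image.
-/
theorem isSeparable_image_of_isSeparable [MeasurableSpace X] {μ : Measure X} [IsFiniteMeasure μ]
    [MeasureTheory.IsSeparable μ] {T : Set X → E} {C : ℝ} (hT : DominatedFinMeasAdditive μ T C) :
    TopologicalSpace.IsSeparable (T '' {A | MeasurableSet A}) := by
  obtain ⟨𝒜, h𝒜c, h𝒜⟩ := exists_countable_measureDense μ
  refine ⟨T '' 𝒜, h𝒜c.image T, ?_⟩
  rintro _ ⟨A, hA, rfl⟩
  refine Metric.mem_closure_iff.2 fun ε hε => ?_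
  have hC : 0 < |C| + 1 := by positivity
  obtain ⟨B, hB, hAB⟩ := h𝒜.approx A hA (measure_ne_top μ A) (ε / (|C| + 1)) (by positivity)
  refine ⟨T B, ⟨B, hB, rfl⟩, ?_⟩
  rw [dist_eq_norm]
  have h1 : μ.real (symmDiff A B) < ε / (|C| + 1) :=
    (ENNReal.lt_ofReal_iff_toReal_lt (measure_ne_top _ _)).1 hAB
  rw [lt_div_iff₀ hC] at h1
  have h2 := hT.norm_sub_le hA (h𝒜.measurable B hB)
  have h3 : (0 : ℝ) ≤ μ.real (symmDiff A B) := measureReal_nonneg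
  nlinarith [le_abs_self C, mul_le_mul_of_nonneg_right (le_abs_self C) h3]

/-- The range of an indefinite Bochner integral is totally bounded. -/
theorem totallyBounded_setIntegral [MeasurableSpace X] {μ : Measure X}
    [IsFiniteMeasure μ] [CompleteSpace E] {f : X → E} (hf : Integrable f μ) :
    TotallyBounded ((fun A => ∫ t in A, f t ∂μ) '' {A | MeasurableSet A}) := by
  refine Integrable.induction (P := fun f : X → E =>
    TotallyBounded ((fun A => ∫ t in A, f t ∂μ) '' {A | MeasurableSet A})) ?_ ?_ ?_ ?_ hf
  · intro c s hs hμs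
    refine ((isCompact_Icc (a := 0) (b := μ.real Set.univ)).image
      (f := fun r : ℝ => r • c) (by fun_prop)).totallyBounded.subset ?_
    rintro _ ⟨A, hA, rfl⟩
    refine ⟨μ.real (A ∩ s), ⟨measureReal_nonneg, measureReal_mono (Set.subset_univ _)⟩, ?_⟩
    simp only
    rw [setIntegral_indicator hs, setIntegral_const]
  -- The range for `f + g` lies in the sum of the two compact closures.
  · intro f g _ hf hg ihf ihg
    refine ((ihf.closure.isCompact_of_isClosed isClosed_closure).add
      (ihg.closure.isCompact_of_isClosed isClosed_closure)).totallyBounded.subset ?_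
    rintro _ ⟨A, hA, rfl⟩
    exact ⟨_, subset_closure ⟨A, hA, rfl⟩, _, subset_closure ⟨A, hA, rfl⟩,
      (integral_add hf.integrableOn hg.integrableOn).symm⟩
  -- Integrals over all sets `A` move by at most the L¹-distance, uniformly in `A`.
  · refine isClosed_of_closure_subset fun f hf => ?_
    refine Metric.totallyBounded_iff.2 fun ε hε => ?_
    obtain ⟨g, hg, hfg⟩ := Metric.mem_closure_iff.1 hf (ε / 2) (half_pos hε)
    obtain ⟨t, ht, hgt⟩ := Metric.totallyBounded_iff.1 hg (ε / 2) (half_pos hε)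
    refine ⟨t, ht, ?_⟩
    rintro _ ⟨A, hA, rfl⟩
    obtain ⟨y, hy, hyA⟩ := Set.mem_iUnion₂.1 (hgt ⟨A, hA, rfl⟩)
    refine Set.mem_iUnion₂.2 ⟨y, hy, ?_⟩
    rw [Metric.mem_ball] at hyA ⊢
    have h1 : dist (∫ t in A, f t ∂μ) (∫ t in A, g t ∂μ) ≤ dist f g := by
      rw [dist_eq_norm, dist_eq_norm, ← integral_sub (L1.integrable_coeFn f).integrableOn
        (L1.integrable_coeFn g).integrableOn, L1.norm_eq_integral_norm]
      refine (norm_integral_le_integral_norm _).trans ?_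
      have e : ∫ t, ‖(f - g : Lp E 1 μ) t‖ ∂μ = ∫ t, ‖f t - g t‖ ∂μ := by
        refine integral_congr_ae ?_
        filter_upwards [Lp.coeFn_sub f g] with t ht
        rw [ht]; rfl
      rw [e]
      exact setIntegral_le_integral
        ((L1.integrable_coeFn f).sub (L1.integrable_coeFn g)).norm
        (.of_forall fun _ => norm_nonneg _)
    calc dist (∫ t in A, f t ∂μ) y ≤ _ := dist_triangle _ (∫ t in A, g t ∂μ) _
      _ < ε := by linarith
  · intro f g hfg _ ih
    convert ih using 2

    exact integral_congr_ae (ae_restrict_of_ae hfg.symm)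

/-- Otherwise some values T(A_n) are ε-separated. The σ-algebra generated by the A_n is countably
generated, so `T` restricted to it has separable range, hence a Bochner density, hence totally
bounded range: a contradiction. -/
theorem totallyBounded_image_of_dominated [MeasurableSpace X] {μ : Measure X}
    [IsFiniteMeasure μ] [CompleteSpace E]
    (hE : Function.Surjective (NormedSpace.inclusionInDoubleDual ℂ E)) {T : Set X → E} {C : ℝ}
    (hT : DominatedFinMeasAdditive μ T C) : TotallyBounded (T '' {A | MeasurableSet A}) := by
  classical
  by_contra hnot
  rw [Metric.totallyBounded_iff] at hnot
  push Not at hnot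
  obtain ⟨ε, hε, hnot⟩ := hnot
  obtain ⟨A, hA, hsep⟩ := exists_seq_of_forall_finset_exists MeasurableSet
    (fun A B => ε ≤ dist (T A) (T B)) fun s _ => by
      obtain ⟨_, ⟨B, hB, rfl⟩, hBs⟩ := Set.not_subset.1 (hnot (T '' s) (s.finite_toSet.image T))
      refine ⟨B, hB, fun A hA => ?_⟩
      by_contra h
      refine hBs (Set.mem_iUnion₂.2 ⟨T A, ⟨A, hA, rfl⟩, ?_⟩)
      rw [Metric.mem_ball, dist_comm]
      exact not_le.1 h
  have hle : MeasurableSpace.generateFrom (Set.range A) ≤ ‹MeasurableSpace X› :=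
    MeasurableSpace.generateFrom_le (by rintro _ ⟨n, rfl⟩; exact hA n)
  have hTB : TotallyBounded
      (T '' {B | MeasurableSet[MeasurableSpace.generateFrom (Set.range A)] B}) := by
    have hT' : DominatedFinMeasAdditive (μ.trim hle) T C := by
      refine ⟨fun s t hs ht _ _ hst => hT.1 s t (hle _ hs) (hle _ ht) (measure_ne_top _ _)
        (measure_ne_top _ _) hst, fun s hs _ => ?_⟩
      rw [measureReal_def, trim_measurableSet_eq hle hs]
      exact hT.2 s (hle _ hs) (measure_lt_top _ _)
    let : MeasurableSpace X := MeasurableSpace.generateFrom (Set.range A)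
    have : MeasurableSpace.CountablyGenerated X := ⟨Set.range A, Set.countable_range A, rfl⟩
    obtain ⟨h, hm, hb, hi⟩ :=
      hasBoundedDensity_of_isSeparable hE hT' (isSeparable_image_of_isSeparable hT')
    have hint : Integrable h (μ.trim hle) := .of_bound hm.aestronglyMeasurable C hb
    refine (totallyBounded_setIntegral hint).subset ?_
    rintro _ ⟨B, hB, rfl⟩
    exact ⟨B, hB, hi B hB⟩
  obtain ⟨t, ht, hcov⟩ := Metric.totallyBounded_iff.1 hTB (ε / 2) (half_pos hε)
  have hmem : ∀ n, ∃ y : t, dist (T (A n)) y < ε / 2 := fun n => by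
    obtain ⟨y, hy, hyA⟩ := Set.mem_iUnion₂.1
      (hcov ⟨A n, MeasurableSpace.measurableSet_generateFrom ⟨n, rfl⟩, rfl⟩)
    exact ⟨⟨y, hy⟩, hyA⟩
  choose y hy using hmem
  have := ht.to_subtype
  obtain ⟨m, n, hmn, he⟩ := Finite.exists_ne_map_eq_of_infinite y
  have hfar : ε ≤ dist (T (A m)) (T (A n)) := by
    rcases lt_or_gt_of_ne hmn with h | h
    · exact hsep m n h
    · rw [dist_comm]; exact hsep n m h
  have h1 := dist_triangle_right (T (A m)) (T (A n)) (y m)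
  have h2 := hy n
  rw [← he] at h2
  linarith [hy m]

/-- A set function with values in a reflexive space that is dominated by a finite measure has a
bounded density. -/
theorem hasBoundedDensity_of_reflexive [MeasurableSpace X] {μ : Measure X}
    [IsFiniteMeasure μ] [CompleteSpace E]
    (hE : Function.Surjective (NormedSpace.inclusionInDoubleDual ℂ E)) {T : Set X → E} {C : ℝ}
    (hT : DominatedFinMeasAdditive μ T C) : HasBoundedDensity μ T C :=
  hasBoundedDensity_of_isSeparable hE hT (totallyBounded_image_of_dominated hE hT).isSeparable

end RadonNikodym

/-! The duality between `L²(X, E^*)` and `L²(X, E)`. -/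

section Pairing

variable {X : Type*} [MeasurableSpace X] {μ : Measure X}
variable {E : Type*} [NormedAddCommGroup E] [NormedSpace ℂ E]

theorem ContinuousLinearMap.isClosed_setOf_norm_le {P Q : Type*} [NormedAddCommGroup P]
    [NormedSpace ℂ P] [NormedAddCommGroup Q] [NormedSpace ℂ Q] (f : Q →L[ℂ] StrongDual ℂ P) :
    IsClosed {q | ‖q‖ ≤ ‖f q‖} := isClosed_le (by fun_prop) (by fun_prop)

/-- A map into a dual space whose values on a dense set are represented through an embedding `f`
that is bounded below factors through `f`. -/
theorem ContinuousLinearMap.exists_comp_eq_of_closure {P Q R : Type*} [NormedAddCommGroup P]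
    [NormedSpace ℂ P] [NormedAddCommGroup Q] [NormedSpace ℂ Q] [CompleteSpace Q]
    [NormedAddCommGroup R] [NormedSpace ℂ R] (f : Q →L[ℂ] StrongDual ℂ P)
    (h : ∀ q, ‖f q‖ = ‖q‖) (g : R →L[ℂ] StrongDual ℂ P) (D : Set R)
    (hD : Dense (Submodule.span ℂ D : Set R)) (hg : ∀ r ∈ D, ∃ q, f q = g r) :
    ∃ W : R →L[ℂ] Q, ∀ r, f (W r) = g r := by
  -- The range of an isometry from a complete space is closed, so it contains all values of `g` once
  -- it contains those on `D`.
  let fi : Q →ₗᵢ[ℂ] StrongDual ℂ P := ⟨f.toLinearMap, h⟩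
  have hc : IsClosed (fi.toLinearMap.range : Set (StrongDual ℂ P)) := by
    rw [LinearMap.coe_range]
    exact fi.isometry.isClosedEmbedding.isClosed_range
  have hmem : ∀ r, g r ∈ fi.toLinearMap.range := fun r => by
    have hcl : IsClosed {r | g r ∈ fi.toLinearMap.range} := hc.preimage g.continuous
    refine hcl.closure_subset_iff.2 (fun r hr => ?_) (hD r)
    have hle : Submodule.span ℂ D ≤ fi.toLinearMap.range.comap g.toLinearMap :=
      Submodule.span_le.2 hg
    exact hle hr
  refine ⟨fi.equivRange.symm.toContinuousLinearEquiv.toContinuousLinearMap.comp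
    (g.codRestrict _ hmem), fun r => ?_⟩
  exact congrArg Subtype.val (fi.equivRange.apply_symm_apply ⟨_, hmem r⟩)

theorem dense_span_indicatorConstLp {p : ℝ≥0∞} [Fact (1 ≤ p)] (hp : p ≠ ∞) :
    Dense (Submodule.span ℂ {G : Lp E p μ | ∃ (A : Set X) (hA : MeasurableSet A) (hμA : μ A ≠ ∞)
      (x : E), G = indicatorConstLp p hA hμA x} : Set (Lp E p μ)) := by
  intro G
  refine Lp.induction hp (motive := fun G => G ∈ closure (Submodule.span ℂ {G : Lp E p μ |
    ∃ (A : Set X) (hA : MeasurableSet A) (hμA : μ A ≠ ∞) (x : E),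
      G = indicatorConstLp p hA hμA x} : Set (Lp E p μ))) ?_ ?_ ?_ G
  · intro x A hA hμA
    rw [Lp.simpleFunc.coe_indicatorConst]
    exact subset_closure (Submodule.subset_span ⟨A, hA, hμA.ne, x, rfl⟩)
  · intro F G hF hG _ h1 h2
    exact (Submodule.topologicalClosure _).add_mem h1 h2
  · exact isClosed_closure

variable (μ E) in
/-- The map `L²(X, E) → L²(X, E^*)^*` given by integration. -/
def flipPairing : Lp E 2 μ →L[ℂ] StrongDual ℂ (Lp (StrongDual ℂ E) 2 μ) :=
  ((ContinuousLinearMap.id ℂ (StrongDual ℂ E)).lpPairing μ 2 2).flip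

theorem flipPairing_apply (G : Lp E 2 μ) (F : Lp (StrongDual ℂ E) 2 μ) :
    flipPairing μ E G F = ∫ t, F t (G t) ∂μ := by
  rw [flipPairing, ContinuousLinearMap.flip_apply, ContinuousLinearMap.lpPairing_eq_integral]
  rfl

theorem norm_flipPairing_le (G : Lp E 2 μ) : ‖flipPairing μ E G‖ ≤ ‖G‖ := by
  refine ContinuousLinearMap.opNorm_le_bound _ (norm_nonneg _) fun F => ?_
  set B := ContinuousLinearMap.id ℂ (StrongDual ℂ E)
  have h1 : flipPairing μ E G F = ∫ t, B.holder 1 F G t ∂μ := by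
    rw [flipPairing_apply]
    refine integral_congr_ae ?_
    filter_upwards [B.coeFn_holder (r := 1) F G] with t ht
    rw [ht]; rfl
  have h2 : ‖B.holder 1 F G‖ ≤ ‖B‖ * ‖F‖ * ‖G‖ := B.norm_holder_apply_apply_le F G
  rw [h1]
  refine (norm_integral_le_integral_norm _).trans ?_
  rw [← L1.norm_eq_integral_norm]
  refine h2.trans ?_
  have h3 : ‖B‖ ≤ 1 := ContinuousLinearMap.norm_id_le
  calc ‖B‖ * ‖F‖ * ‖G‖ ≤ 1 * ‖F‖ * ‖G‖ := by gcongr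
    _ = ‖G‖ * ‖F‖ := by ring

/-- For a simple function f the test function ‖f‖ φ_f, with φ_x norming x, is again simple, so no
measurable selection is needed. It has norm at most ‖f‖ and pairs with f to ‖f‖². -/
theorem norm_le_norm_flipPairing (G : Lp E 2 μ) : ‖G‖ ≤ ‖flipPairing μ E G‖ := by
  refine (Lp.simpleFunc.denseRange (E := E) (μ := μ) (p := 2) ENNReal.ofNat_ne_top).induction_on G
    (ContinuousLinearMap.isClosed_setOf_norm_le (flipPairing μ E)) fun s => ?_
  choose φ hφ hφx using fun x : E => exists_dual_vector'' ℂ x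
  set f := Lp.simpleFunc.toSimpleFunc s
  have hf : f =ᵐ[μ] (s : Lp E 2 μ) := Lp.simpleFunc.toSimpleFunc_eq_toFun s
  have hfm : MemLp f 2 μ := Lp.simpleFunc.memLp s
  let F₀ : SimpleFunc X (StrongDual ℂ E) := f.map fun x => (‖x‖ : ℂ) • φ x
  have hF₀ : ∀ t, ‖F₀ t‖ ≤ ‖f t‖ := fun t => by
    simp only [F₀, SimpleFunc.map_apply, norm_smul, Complex.norm_real, norm_norm]
    exact mul_le_of_le_one_right (norm_nonneg _) (hφ _)
  have hF₀m : MemLp F₀ 2 μ := hfm.of_le F₀.aestronglyMeasurable (.of_forall hF₀)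
  set F := hF₀m.toLp
  have hFs : ‖F‖ ≤ ‖(s : Lp E 2 μ)‖ := by
    refine Lp.norm_le_norm_of_ae_le ?_
    filter_upwards [hF₀m.coeFn_toLp, hf] with t h1 h2
    rw [h1, ← h2]
    exact hF₀ t
  have hsq : ‖(s : Lp E 2 μ)‖ ^ 2 = ∫ t, ‖f t‖ ^ 2 ∂μ := by
    have hnn : 0 ≤ ∫ t, ‖f t‖ ^ 2 ∂μ := integral_nonneg fun t => by positivity
    rw [Lp.norm_def, eLpNorm_congr_ae hf.symm,
      hfm.eLpNorm_eq_integral_rpow_norm two_ne_zero ENNReal.ofNat_ne_top]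
    simp only [ENNReal.toReal_ofNat, Real.rpow_ofNat]
    rw [ENNReal.toReal_ofReal (by positivity), ← one_div, ← Real.sqrt_eq_rpow, Real.sq_sqrt hnn]
  have hpair : flipPairing μ E s F = ((‖(s : Lp E 2 μ)‖ ^ 2 : ℝ) : ℂ) := by
    rw [flipPairing_apply, hsq, ← integral_complex_ofReal]
    refine integral_congr_ae ?_
    filter_upwards [hF₀m.coeFn_toLp, hf] with t h1 h2
    rw [h1, ← h2]
    simp [F₀, hφx, sq]
  have h1 := (flipPairing μ E (s : Lp E 2 μ)).le_opNorm F
  rw [hpair, Complex.norm_real, norm_pow, norm_norm] at h1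
  by_contra hlt
  push Not at hlt
  have h2 := h1.trans (mul_le_mul_of_nonneg_left hFs (norm_nonneg _))
  nlinarith [norm_nonneg (flipPairing μ E (s : Lp E 2 μ))]

theorem ProjTensor.norm_tmulL_le_one (F G : Type*) [NormedAddCommGroup F] [NormedSpace ℂ F]
    [NormedAddCommGroup G] [NormedSpace ℂ G] : ‖tmulL (E := F) (F := G)‖ ≤ 1 :=
  LinearMap.mkContinuous₂_norm_le _ zero_le_one _

theorem ProjTensor.norm_tmulL_apply_le {F G : Type*} [NormedAddCommGroup F] [NormedSpace ℂ F]
    [NormedAddCommGroup G] [NormedSpace ℂ G] (x : F) (y : G) : ‖tmulL x y‖ ≤ ‖x‖ * ‖y‖ := by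
  rw [tmulL_apply, UniformSpace.Completion.norm_coe]
  exact ProjAlg.norm_mk_le x y

theorem l2Pairing_tmul_eq_flipPairing (W : Lp E 2 μ →L[ℂ] Lp E 2 μ)
    (F : Lp (StrongDual ℂ E) 2 μ) (G : Lp E 2 μ) :
    l2Pairing W (ProjTensor.tmulL F G) = flipPairing μ E (W G) F := by
  rw [l2Pairing_tmul, flipPairing_apply]

theorem norm_l2Pairing (W : Lp E 2 μ →L[ℂ] Lp E 2 μ) : ‖l2Pairing W‖ = ‖W‖ := by
  refine le_antisymm ?_ ?_
  · refine ContinuousLinearMap.opNorm_le_bound _ (norm_nonneg _) fun τ => ?_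
    refine (ProjTensor.norm_lift_apply_le _ τ).trans ?_
    refine mul_le_mul_of_nonneg_right ?_ (norm_nonneg _)
    refine ContinuousLinearMap.opNorm_le_bound₂ _ (norm_nonneg _) fun F G => ?_
    change ‖flipPairing μ E (W G) F‖ ≤ _
    calc ‖flipPairing μ E (W G) F‖ ≤ ‖W G‖ * ‖F‖ :=
          (ContinuousLinearMap.le_opNorm _ _).trans (by gcongr; exact norm_flipPairing_le _)
      _ ≤ ‖W‖ * ‖G‖ * ‖F‖ := by gcongr; exact W.le_opNorm G
      _ = _ := by ring
  · refine ContinuousLinearMap.opNorm_le_bound _ (norm_nonneg _) fun G => ?_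
    refine (norm_le_norm_flipPairing _).trans ?_
    refine ContinuousLinearMap.opNorm_le_bound _ (by positivity) fun F => ?_
    rw [← l2Pairing_tmul_eq_flipPairing]
    calc _ ≤ ‖l2Pairing W‖ * ‖ProjTensor.tmulL F G‖ := ContinuousLinearMap.le_opNorm _ _
      _ ≤ ‖l2Pairing W‖ * (‖F‖ * ‖G‖) := by gcongr; exact ProjTensor.norm_tmulL_apply_le F G
      _ = _ := by ring

theorem LambdaMap_indicator {A B : Set X} (hA : MeasurableSet A) (hμA : μ A ≠ ∞)
    (hB : MeasurableSet B) (hμB : μ B ≠ ∞) (φ : StrongDual ℂ E) (x : E) :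
    LambdaMap μ E (ProjTensor.tmulL (indicatorConstLp 2 hA hμA φ) (indicatorConstLp 2 hB hμB x)) =
      indicatorConstLp 1 (hA.inter hB) (measure_ne_top_of_subset Set.inter_subset_left hμA)
        (ProjTensor.tmulL φ x) := by
  refine Lp.ext ?_
  filter_upwards [LambdaMap_tmul μ (indicatorConstLp 2 hA hμA φ) (indicatorConstLp 2 hB hμB x),
    indicatorConstLp_coeFn (p := 2) (hs := hA) (hμs := hμA) (c := φ),
    indicatorConstLp_coeFn (p := 2) (hs := hB) (hμs := hμB) (c := x),
    indicatorConstLp_coeFn (p := 1) (hs := hA.inter hB)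
      (hμs := measure_ne_top_of_subset Set.inter_subset_left hμA)
      (c := ProjTensor.tmulL φ x)] with t h1 h2 h3 h4
  rw [h1, h2, h3, h4]
  by_cases hA : t ∈ A <;> by_cases hB : t ∈ B <;> simp [hA, hB]

/-- The functional `F ↦ ⟨π, Λ (F ⊗ G)⟩` on `L²(X, E^*)`, as a function of `G`. -/
def l1Functional (π : Lp ℂ 1 μ →L[ℂ] (E →L[ℂ] E)) :
    Lp E 2 μ →L[ℂ] StrongDual ℂ (Lp (StrongDual ℂ E) 2 μ) :=
  (ContinuousLinearMap.compL ℂ _ _ ℂ ((l1Pairing π).comp (LambdaMap μ E))).comp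
    ProjTensor.tmulL.flip

theorem l1Functional_apply (π : Lp ℂ 1 μ →L[ℂ] (E →L[ℂ] E)) (G : Lp E 2 μ)
    (F : Lp (StrongDual ℂ E) 2 μ) :
    l1Functional π G F = l1Pairing π (LambdaMap μ E (ProjTensor.tmulL F G)) := rfl

/-- `H` is the Radon–Nikodym density of B ↦ π(χ_{B ∩ A}) x on `A`, extended by zero; being bounded
on a set of finite measure, it lies in L². -/
theorem exists_flipPairing_eq_indicator [CompleteSpace E]
    (hE : Function.Surjective (NormedSpace.inclusionInDoubleDual ℂ E))
    (π : Lp ℂ 1 μ →L[ℂ] (E →L[ℂ] E)) {A : Set X} (hA : MeasurableSet A) (hμA : μ A ≠ ∞) (x : E) :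
    ∃ H, flipPairing μ E H = l1Functional π (indicatorConstLp 2 hA hμA x) := by
  classical
  have : IsFiniteMeasure (μ.restrict A) := isFiniteMeasure_restrict.2 hμA
  have hfin : ∀ B, μ (B ∩ A) ≠ ∞ := fun B => measure_ne_top_of_subset Set.inter_subset_right hμA
  let T : Set X → E := fun B =>
    if hB : MeasurableSet B then π (indicatorConstLp 1 (hB.inter hA) (hfin B) 1) x else 0
  have hT : DominatedFinMeasAdditive (μ.restrict A) T (‖π‖ * ‖x‖) := by
    refine ⟨fun s t hs ht _ _ hst => ?_, fun s hs _ => ?_⟩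
    · simp only [T]
      rw [dif_pos hs, dif_pos ht, dif_pos (hs.union ht), ← _root_.add_apply,
        ← map_add, ← indicatorConstLp_disjoint_union (hs.inter hA) (ht.inter hA) (hfin s) (hfin t)
          (hst.mono Set.inter_subset_left Set.inter_subset_left)]
      simp only [Set.union_inter_distrib_right]
    · simp only [T]
      rw [dif_pos hs]
      have h1 := (π (indicatorConstLp 1 (hs.inter hA) (hfin s) 1)).le_of_opNorm_le
        (π.le_opNorm _) x
      rw [norm_indicatorConstLp one_ne_zero ENNReal.one_ne_top] at h1
      refine h1.trans (le_of_eq ?_)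
      rw [measureReal_restrict_apply hs]
      simp only [norm_one, ENNReal.toReal_one, div_one, Real.rpow_one, one_mul]
      ring
  obtain ⟨h, hm, hb, hi⟩ := hasBoundedDensity_of_reflexive hE hT
  have hmem : MemLp (A.indicator h) 2 μ := by
    rw [memLp_indicator_iff_restrict hA]
    exact .of_bound hm.aestronglyMeasurable _ hb
  have hint : Integrable h (μ.restrict A) := .of_bound hm.aestronglyMeasurable _ hb
  refine ⟨hmem.toLp, ?_⟩
  ext F
  refine Lp.induction (p := 2) ENNReal.ofNat_ne_top
    (motive := fun F => flipPairing μ E hmem.toLp F =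
      l1Functional π (indicatorConstLp 2 hA hμA x) F) ?_ ?_ ?_ F
  · intro φ B hB hμB
    rw [Lp.simpleFunc.coe_indicatorConst, l1Functional_apply, LambdaMap_indicator,
      l1Pairing_indicator, flipPairing_apply]
    have e : ∫ t, (indicatorConstLp 2 hB hμB.ne φ : X → StrongDual ℂ E) t (hmem.toLp _ t) ∂μ =
        ∫ t, B.indicator (A.indicator fun t => φ (h t)) t ∂μ := by
      refine integral_congr_ae ?_
      filter_upwards [hmem.coeFn_toLp, indicatorConstLp_coeFn (p := 2) (hs := hB)
        (hμs := hμB.ne) (c := φ)] with t h1 h2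
      rw [h1, h2]
      by_cases htA : t ∈ A <;> by_cases htB : t ∈ B <;> simp [htA, htB]
    rw [e, integral_indicator hB, integral_indicator hA, Measure.restrict_restrict hA,
      Set.inter_comm, ← Measure.restrict_restrict hB, φ.integral_comp_comm hint.integrableOn,
      hi B hB]
    simp only [T, dif_pos hB]
  · intro F G hF hG _ h1 h2
    rw [map_add, map_add, h1, h2]
  · exact isClosed_eq (by fun_prop) (by fun_prop)

/-- The adjoint of `Λ` takes its values in the bounded operators on `L²(X, E)`. -/
theorem exists_l2Pairing_eq [CompleteSpace E]
    (hE : Function.Surjective (NormedSpace.inclusionInDoubleDual ℂ E))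
    (π : Lp ℂ 1 μ →L[ℂ] (E →L[ℂ] E)) :
    ∃ W : Lp E 2 μ →L[ℂ] Lp E 2 μ, l2Pairing W = (l1Pairing π).comp (LambdaMap μ E) := by
  obtain ⟨W, hW⟩ := ContinuousLinearMap.exists_comp_eq_of_closure (flipPairing μ E)
    (fun G => le_antisymm (norm_flipPairing_le G) (norm_le_norm_flipPairing G)) (l1Functional π)
    {G | ∃ (A : Set X) (hA : MeasurableSet A) (hμA : μ A ≠ ∞) (x : E),
      G = indicatorConstLp 2 hA hμA x} (dense_span_indicatorConstLp ENNReal.ofNat_ne_top) (by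
        rintro _ ⟨A, hA, hμA, x, rfl⟩
        exact exists_flipPairing_eq_indicator hE π hA hμA x)
  refine ⟨W, ProjTensor.ext_tmul fun F G => ?_⟩
  rw [l2Pairing_tmul_eq_flipPairing, hW]
  rfl

end Pairing

/-! Metric surjections. -/

section MetricSurjection

variable {V W : Type*} [NormedAddCommGroup V] [NormedSpace ℂ V] [CompleteSpace V]
  [NormedAddCommGroup W] [NormedSpace ℂ W]

/-- Approximate preimages with norm control yield exact preimages with norm control. -/
theorem ContinuousLinearMap.exists_preimage_norm_lt_of_approx (f : V →L[ℂ] W)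
    (h : ∀ (y : W) (ε : ℝ), 0 < ε → ∃ x, ‖f x - y‖ < ε ∧ ‖x‖ < ‖y‖ + ε) (y : W) {ε : ℝ}
    (hε : 0 < ε) : ∃ x, f x = y ∧ ‖x‖ < ‖y‖ + ε := by
  choose! g hg1 hg2 using h
  -- The `n`-th residual is corrected up to an error `δ n`. The first term exceeds ‖y‖ by less than
  -- ε/8 and the others sum to at most ε/2, which leaves the total below ‖y‖ + ε.
  let δ : ℕ → ℝ := fun n => ε / 8 * (1 / 2) ^ n
  have hδ : ∀ n, 0 < δ n := fun n => by positivity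
  have hδsum : HasSum δ (ε / 4) := by
    have := hasSum_geometric_two.mul_left (ε / 8)
    rwa [show ε / 8 * 2 = ε / 4 by ring] at this
  let r : ℕ → W := fun n => Nat.rec y (fun n z => z - f (g z (δ n))) n
  have hr : ∀ n, r (n + 1) = r n - f (g (r n) (δ n)) := fun n => rfl
  let x : ℕ → V := fun n => g (r n) (δ n)
  have hr1 : ∀ n, ‖r (n + 1)‖ < δ n := fun n => by
    rw [hr, norm_sub_rev]
    exact hg1 _ _ (hδ n)
  have hx0 : ‖x 0‖ < ‖y‖ + ε / 8 := by simpa [x, r, δ] using hg2 y (δ 0) (hδ 0)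
  have hx1 : ∀ n, ‖x (n + 1)‖ ≤ 2 * δ n := fun n => by
    have h1 := hg2 (r (n + 1)) (δ (n + 1)) (hδ _)
    have h2 : δ (n + 1) = δ n / 2 := by simp only [δ, pow_succ]; ring
    have := hr1 n
    have := hδ n
    simp only [x]
    linarith
  have hs1 : Summable fun n => ‖x (n + 1)‖ :=
    .of_nonneg_of_le (fun n => norm_nonneg _) hx1 (hδsum.summable.mul_left 2)
  have hs : Summable x := ((summable_nat_add_iff 1).1 hs1).of_norm
  have hsumr : ∀ n, ∑ i ∈ Finset.range n, f (x i) = y - r n := fun n => by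
    induction n with
    | zero => simp [r]
    | succ n ih => rw [Finset.sum_range_succ, ih, hr]; simp only [x]; abel
  have hr0 : Filter.Tendsto r Filter.atTop (𝓝 0) := by
    rw [← Filter.tendsto_add_atTop_iff_nat 1]
    exact squeeze_zero_norm (fun n => (hr1 n).le) hδsum.summable.tendsto_atTop_zero
  refine ⟨∑' n, x n, ?_, ?_⟩
  · refine tendsto_nhds_unique ((hs.hasSum.mapL f).tendsto_sum_nat) ?_
    simp only [hsumr]
    simpa using tendsto_const_nhds.sub hr0
  · rw [hs.tsum_eq_zero_add]
    have h1 : ‖∑' n, x (n + 1)‖ ≤ 2 * (ε / 4) :=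
      tsum_of_norm_bounded (hδsum.mul_left 2) hx1
    have := norm_add_le (x 0) (∑' n, x (n + 1))
    linarith

/-- Composition with a metric surjection preserves the norm of functionals. -/
theorem ContinuousLinearMap.norm_comp_eq_of_metric_surjection (f : V →L[ℂ] W)
    (hf : ∀ x, ‖f x‖ ≤ ‖x‖)
    (h : ∀ (y : W) (ε : ℝ), 0 < ε → ∃ x, f x = y ∧ ‖x‖ < ‖y‖ + ε) (ψ : StrongDual ℂ W) :
    ‖ψ.comp f‖ = ‖ψ‖ := by
  refine le_antisymm ?_ ?_
  · refine ContinuousLinearMap.opNorm_le_bound _ (norm_nonneg _) fun x => ?_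
    exact (ψ.le_opNorm _).trans (by gcongr; exact hf x)
  · refine ContinuousLinearMap.opNorm_le_bound _ (norm_nonneg _) fun y => ?_
    have h1 : ∀ ε : ℝ, 0 < ε → ‖ψ y‖ ≤ ‖ψ.comp f‖ * (‖y‖ + ε) := fun ε hε => by
      obtain ⟨x, rfl, hx⟩ := h y ε hε
      exact ((ψ.comp f).le_opNorm x).trans (by gcongr)
    have h2 : Filter.Tendsto (fun ε : ℝ => ‖ψ.comp f‖ * (‖y‖ + ε)) (𝓝[>] 0)
        (𝓝 (‖ψ.comp f‖ * (‖y‖ + 0))) :=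
      ((continuous_const.mul (continuous_const.add continuous_id)).tendsto 0).mono_left
        nhdsWithin_le_nhds
    rw [add_zero] at h2
    exact ge_of_tendsto h2 (eventually_mem_nhdsWithin.mono fun ε hε => h1 ε hε)

/-- A functional that vanishes on the kernel of a surjection factors through it. -/
theorem ContinuousLinearMap.exists_comp_eq_of_ker_le [CompleteSpace W] (f : V →L[ℂ] W)
    (hf : Function.Surjective f) (κ : StrongDual ℂ V) (h : ∀ x, f x = 0 → κ x = 0) :
    ∃ ψ : StrongDual ℂ W, κ = ψ.comp f := by
  let ψ : W →ₗ[ℂ] ℂ := (f.toLinearMap.ker.liftQ κ.toLinearMap h) ∘ₗ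
    (f.toLinearMap.quotKerEquivOfSurjective hf).symm.toLinearMap
  have hψ : ∀ x, ψ (f x) = κ x := fun x => by
    have : (f.toLinearMap.quotKerEquivOfSurjective hf).symm (f x) =
        Submodule.Quotient.mk x := by
      rw [LinearEquiv.symm_apply_eq]; rfl
    simp only [ψ, LinearMap.comp_apply, LinearEquiv.coe_coe, this]
    rfl
  -- By the open mapping theorem `f` is a quotient map.
  have hc : Continuous ψ := (f.isQuotientMap hf).continuous_iff.2 (by
    have : ψ ∘ f = κ := funext hψ
    rw [this]; exact κ.continuous)
  exact ⟨⟨ψ, hc⟩, by ext x; exact (hψ x).symm⟩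

end MetricSurjection

/-! ### The metric surjectivity of Λ. -/

section Lambda

variable {X : Type*} [MeasurableSpace X] {μ : Measure X}
variable {E : Type*} [NormedAddCommGroup E] [NormedSpace ℂ E]

theorem norm_LambdaMap_le (τ : ProjTensor (Lp (StrongDual ℂ E) 2 μ) (Lp E 2 μ)) :
    ‖LambdaMap μ E τ‖ ≤ ‖τ‖ := by
  refine (ProjTensor.norm_lift_apply_le _ τ).trans (mul_le_of_le_one_left (norm_nonneg _) ?_)
  exact (ContinuousLinearMap.norm_holderL_le _).trans (ProjTensor.norm_tmulL_le_one _ _)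

theorem norm_indicatorConstLp_one_eq {V : Type*} [NormedAddCommGroup V] {A : Set X}
    (hA : MeasurableSet A) (hμA : μ A ≠ ∞) (u : V) :
    ‖indicatorConstLp 1 hA hμA u‖ = μ.real A * ‖u‖ := by
  rw [norm_indicatorConstLp one_ne_zero ENNReal.one_ne_top]
  simp [mul_comm]

theorem norm_indicatorConstLp_two_mul {V W : Type*} [NormedAddCommGroup V] [NormedAddCommGroup W]
    {A : Set X} (hA : MeasurableSet A) (hμA : μ A ≠ ∞) (u : V) (v : W) :
    ‖indicatorConstLp 2 hA hμA u‖ * ‖indicatorConstLp 2 hA hμA v‖ = μ.real A * (‖u‖ * ‖v‖) := by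
  rw [norm_indicatorConstLp two_ne_zero ENNReal.ofNat_ne_top,
    norm_indicatorConstLp two_ne_zero ENNReal.ofNat_ne_top]
  have h : μ.real A ^ (1 / (2 : ℝ≥0∞).toReal) * μ.real A ^ (1 / (2 : ℝ≥0∞).toReal) = μ.real A := by
    rw [ENNReal.toReal_ofNat, ← Real.sqrt_eq_rpow, Real.mul_self_sqrt measureReal_nonneg]
  calc _ = ‖u‖ * ‖v‖ *
        (μ.real A ^ (1 / (2 : ℝ≥0∞).toReal) * μ.real A ^ (1 / (2 : ℝ≥0∞).toReal)) := by ring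
    _ = _ := by rw [h]; ring

theorem exists_LambdaMap_eq_indicator {A : Set X} (hA : MeasurableSet A) (hμA : μ A ≠ ∞)
    (l : List (StrongDual ℂ E × E)) :
    ∃ τ, LambdaMap μ E τ = indicatorConstLp 1 hA hμA
        (((l.map fun q => ProjAlg.mk q.1 q.2).sum : ProjAlg (StrongDual ℂ E) E) :
          ProjTensor (StrongDual ℂ E) E) ∧
      ‖τ‖ ≤ μ.real A * ProjAlg.cost l := by
  induction l with
  | nil =>
    refine ⟨0, ?_, by simp [ProjAlg.cost]⟩
    rw [map_zero, List.map_nil, List.sum_nil, UniformSpace.Completion.coe_zero,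
      ← norm_eq_zero.1 ((norm_indicatorConstLp_one_eq hA hμA
        (0 : ProjTensor (StrongDual ℂ E) E)).trans (by simp))]
  | cons q l ih =>
    obtain ⟨τ, hτ, hn⟩ := ih
    refine ⟨ProjTensor.tmulL (indicatorConstLp 2 hA hμA q.1) (indicatorConstLp 2 hA hμA q.2) + τ,
      ?_, ?_⟩
    · rw [map_add, hτ, LambdaMap_indicator, List.map_cons, List.sum_cons,
        UniformSpace.Completion.coe_add, ← indicatorConstLp_add, ← ProjTensor.tmulL_apply]
      simp only [Set.inter_self]
    · refine (norm_add_le _ _).trans ?_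
      have h1 := ProjTensor.norm_tmulL_apply_le (indicatorConstLp 2 hA hμA q.1)
        (indicatorConstLp 2 hA hμA q.2)
      rw [norm_indicatorConstLp_two_mul] at h1
      simp only [ProjAlg.cost, List.map_cons, List.sum_cons, mul_add] at hn ⊢
      exact add_le_add h1 hn

theorem exists_norm_LambdaMap_sub_lt (H : Lp (ProjTensor (StrongDual ℂ E) E) 1 μ) :
    ∀ ε : ℝ, 0 < ε → ∃ τ, ‖LambdaMap μ E τ - H‖ < ε ∧ ‖τ‖ < ‖H‖ + ε := by
  refine Lp.induction ENNReal.one_ne_top (motive := fun H => ∀ ε : ℝ, 0 < ε →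
    ∃ τ, ‖LambdaMap μ E τ - H‖ < ε ∧ ‖τ‖ < ‖H‖ + ε) ?_ ?_ ?_ H
  · intro u A hA hμA ε hε
    rw [Lp.simpleFunc.coe_indicatorConst]
    have ha : 0 ≤ μ.real A := measureReal_nonneg
    -- Approximating `u` and then choosing a representation cost `δ` each, scaled by μ(A); the `+ 1`
    -- covers μ(A) = 0.
    set δ := ε / (2 * (μ.real A + 1))
    have hδ : 0 < δ := by positivity
    have hδε : 2 * δ * (μ.real A + 1) = ε := by simp only [δ]; field_simp
    obtain ⟨v, hv⟩ := UniformSpace.Completion.denseRange_coe.exists_dist_lt u hδ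
    obtain ⟨⟨l, rfl⟩, hl⟩ := exists_lt_of_ciInf_lt
      (show (⨅ l : ProjAlg.Rep v, ProjAlg.cost l.1) < ‖v‖ + δ by
        rw [← ProjAlg.norm_def]; linarith)
    obtain ⟨τ, hτ, hn⟩ := exists_LambdaMap_eq_indicator hA hμA.ne l
    set v := (l.map fun q => ProjAlg.mk q.1 q.2).sum
    rw [dist_eq_norm] at hv
    refine ⟨τ, ?_, ?_⟩
    · have e : indicatorConstLp 1 hA hμA.ne u = indicatorConstLp 1 hA hμA.ne
          (u - (v : ProjTensor (StrongDual ℂ E) E)) + indicatorConstLp 1 hA hμA.ne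
          (v : ProjTensor (StrongDual ℂ E) E) := by
        rw [indicatorConstLp_add, sub_add_cancel]
      rw [hτ, e, norm_sub_rev, add_sub_cancel_right, norm_indicatorConstLp_one_eq]
      nlinarith
    · have h1 : ‖v‖ ≤ ‖u‖ + δ := by
        have h2 := norm_sub_norm_le (v : ProjTensor (StrongDual ℂ E) E) u
        rw [norm_sub_rev, UniformSpace.Completion.norm_coe] at h2
        linarith
      rw [norm_indicatorConstLp_one_eq]
      simp only at hl
      nlinarith
  · intro f g hf hg hfg ihf ihg ε hε
    obtain ⟨σ, h1, h2⟩ := ihf (ε / 2) (half_pos hε)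
    obtain ⟨τ, h3, h4⟩ := ihg (ε / 2) (half_pos hε)
    -- Disjoint supports make the L¹-norm additive, so the two norm bounds add up without loss.
    have hnorm : ‖hf.toLp f + hg.toLp g‖ = ‖hf.toLp f‖ + ‖hg.toLp g‖ := by
      rw [L1.norm_eq_integral_norm, L1.norm_eq_integral_norm, L1.norm_eq_integral_norm,
        ← integral_add (L1.integrable_coeFn _).norm (L1.integrable_coeFn _).norm]
      refine integral_congr_ae ?_
      filter_upwards [Lp.coeFn_add (hf.toLp f) (hg.toLp g), hf.coeFn_toLp, hg.coeFn_toLp]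
        with t h1 h2 h3
      rw [h1, Pi.add_apply, h2, h3]
      by_cases ht : f t = 0
      · simp [ht]
      · have : g t = 0 := by
          by_contra h
          exact Set.disjoint_left.1 hfg ht h
        simp [this]
    refine ⟨σ + τ, ?_, ?_⟩
    · rw [map_add, add_sub_add_comm]
      exact (norm_add_le _ _).trans_lt (by linarith)
    · rw [hnorm]
      exact (norm_add_le _ _).trans_lt (by linarith)
  · refine isClosed_of_closure_subset fun H hH ε hε => ?_
    obtain ⟨H', hH', hd⟩ := Metric.mem_closure_iff.1 hH (ε / 2) (half_pos hε)
    obtain ⟨τ, h1, h2⟩ := hH' (ε / 2) (half_pos hε)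
    rw [dist_eq_norm] at hd
    refine ⟨τ, ?_, ?_⟩
    · have := norm_sub_le_norm_sub_add_norm_sub (LambdaMap μ E τ) H' H
      rw [norm_sub_rev H' H] at this
      linarith
    · have := norm_sub_norm_le H' H
      rw [norm_sub_rev H' H] at this
      linarith

theorem exists_LambdaMap_eq (H : Lp (ProjTensor (StrongDual ℂ E) E) 1 μ) (ε : ℝ) (hε : 0 < ε) :
    ∃ τ, LambdaMap μ E τ = H ∧ ‖τ‖ < ‖H‖ + ε :=
  (LambdaMap μ E).exists_preimage_norm_lt_of_approx exists_norm_LambdaMap_sub_lt H hε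

theorem LambdaMap_image_ball :
    LambdaMap μ E '' Metric.ball 0 1 = Metric.ball 0 1 := by
  refine Set.Subset.antisymm ?_ fun H hH => ?_
  · rintro _ ⟨τ, hτ, rfl⟩
    rw [mem_ball_zero_iff] at hτ ⊢
    exact (norm_LambdaMap_le τ).trans_lt hτ
  · rw [mem_ball_zero_iff] at hH
    obtain ⟨τ, hτ, hn⟩ := exists_LambdaMap_eq H (1 - ‖H‖) (sub_pos.2 hH)
    refine ⟨τ, ?_, hτ⟩
    rw [mem_ball_zero_iff]
    linarith

end Lambda

/-! The dual of `L¹(X, E^* ⊗̂ E)`. -/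

section Trace

variable {E : Type*} [NormedAddCommGroup E] [NormedSpace ℂ E]

/-- For reflexive `E` every functional on `E^* ⊗̂ E` comes from a bounded operator. -/
theorem exists_tracePairing_eq (hE : Function.Surjective (NormedSpace.inclusionInDoubleDual ℂ E)) :
    ∃ R : StrongDual ℂ (ProjTensor (StrongDual ℂ E) E) →L[ℂ] (E →L[ℂ] E),
      ∀ κ, tracePairing (R κ) = κ := by
  let J : E ≃ₗᵢ[ℂ] StrongDual ℂ (StrongDual ℂ E) :=
    LinearIsometryEquiv.ofSurjective (NormedSpace.inclusionInDoubleDualLi ℂ) hE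
  have hJ : ∀ (Ψ : StrongDual ℂ (StrongDual ℂ E)) (φ : StrongDual ℂ E), φ (J.symm Ψ) = Ψ φ :=
    fun Ψ φ => by
      have : J (J.symm Ψ) = Ψ := J.apply_symm_apply Ψ
      exact congrArg (fun Θ : StrongDual ℂ (StrongDual ℂ E) => Θ φ) this
  let R : StrongDual ℂ (ProjTensor (StrongDual ℂ E) E) →L[ℂ] (E →L[ℂ] E) :=
    LinearMap.mkContinuous
      { toFun := fun κ => J.symm.toContinuousLinearEquiv.toContinuousLinearMap.comp
          ((ContinuousLinearMap.compL ℂ _ _ ℂ κ).comp ProjTensor.tmulL.flip)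
        map_add' := fun κ κ' => by ext x; simp
        map_smul' := fun c κ => by ext x; simp }
      1 (fun κ => by
        refine ContinuousLinearMap.opNorm_le_bound _ (by positivity) fun x => ?_
        change ‖J.symm (κ.comp (ProjTensor.tmulL.flip x))‖ ≤ _
        rw [J.symm.norm_map, one_mul]
        refine ContinuousLinearMap.opNorm_le_bound _ (by positivity) fun φ => ?_
        change ‖κ (ProjTensor.tmulL φ x)‖ ≤ _
        calc _ ≤ ‖κ‖ * ‖ProjTensor.tmulL φ x‖ := κ.le_opNorm _
          _ ≤ ‖κ‖ * (‖φ‖ * ‖x‖) := by gcongr; exact ProjTensor.norm_tmulL_apply_le _ _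
          _ = _ := by ring)
  refine ⟨R, fun κ => ProjTensor.ext_tmul fun φ x => ?_⟩
  rw [tracePairing_tmul]
  exact hJ _ φ

end Trace

section Dual

variable {X : Type*} [MeasurableSpace X] {μ : Measure X}
variable {E : Type*} [NormedAddCommGroup E] [NormedSpace ℂ E]

theorem l1Pairing_indicator_eq_tracePairing (π : Lp ℂ 1 μ →L[ℂ] (E →L[ℂ] E)) {A : Set X}
    (hA : MeasurableSet A) (hμA : μ A ≠ ∞) (u : ProjTensor (StrongDual ℂ E) E) :
    l1Pairing π (indicatorConstLp 1 hA hμA u) =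
      tracePairing (π (indicatorConstLp 1 hA hμA 1)) u := by
  rw [l1Pairing, ← L1.setToL1_eq_setToL1', L1.setToL1_indicatorConstLp, l1SetFun,
    dif_pos ⟨hA, hμA⟩]
  rfl

/-- The map `f ↦ f ⊗ u` from `L¹(X)` to `L¹(X, V)`, as a bilinear map. -/
def constTensor (μ : Measure X) (V : Type*) [NormedAddCommGroup V] [NormedSpace ℂ V] :
    V →L[ℂ] Lp ℂ 1 μ →L[ℂ] Lp V 1 μ :=
  LinearMap.mkContinuous₂
    (LinearMap.mk₂ ℂ (fun u f => (ContinuousLinearMap.toSpanSingleton ℂ u).compLp f)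
      (fun u v f => by
        rw [← ContinuousLinearMap.add_compLp, ContinuousLinearMap.toSpanSingleton_add])
      (fun c u f => by
        rw [← ContinuousLinearMap.smul_compLp, ContinuousLinearMap.toSpanSingleton_smul])
      (fun u f g => ((ContinuousLinearMap.toSpanSingleton ℂ u).compLpL 1 μ).map_add f g)
      (fun c u f => ((ContinuousLinearMap.toSpanSingleton ℂ u).compLpL 1 μ).map_smul c f))
    1 (fun u f => by
      rw [one_mul]
      change ‖(ContinuousLinearMap.toSpanSingleton ℂ u).compLp f‖ ≤ _
      refine (ContinuousLinearMap.norm_compLp_le _ _).trans ?_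
      rw [ContinuousLinearMap.norm_toSpanSingleton])

theorem constTensor_indicator {V : Type*} [NormedAddCommGroup V] [NormedSpace ℂ V] {A : Set X}
    (hA : MeasurableSet A) (hμA : μ A ≠ ∞) (u : V) :
    constTensor μ V u (indicatorConstLp 1 hA hμA 1) = indicatorConstLp 1 hA hμA u := by
  refine Lp.ext ?_
  filter_upwards [(ContinuousLinearMap.toSpanSingleton ℂ u).coeFn_compLp
      (indicatorConstLp 1 hA hμA (1 : ℂ)),
    indicatorConstLp_coeFn (p := 1) (hs := hA) (hμs := hμA) (c := (1 : ℂ)),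
    indicatorConstLp_coeFn (p := 1) (hs := hA) (hμs := hμA) (c := u)] with t h1 h2 h3
  refine h1.trans ?_
  rw [h2, h3]
  by_cases ht : t ∈ A <;> simp [ht]

theorem norm_constTensor_apply_le {V : Type*} [NormedAddCommGroup V] [NormedSpace ℂ V] (u : V)
    (f : Lp ℂ 1 μ) : ‖constTensor μ V u f‖ ≤ ‖u‖ * ‖f‖ := by
  refine (ContinuousLinearMap.norm_compLp_le _ _).trans ?_
  rw [ContinuousLinearMap.norm_toSpanSingleton]

theorem ContinuousLinearMap.ext_indicatorConstLp {V W : Type*} [NormedAddCommGroup V]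
    [NormedSpace ℂ V] [NormedAddCommGroup W] [NormedSpace ℂ W] {S T : Lp V 1 μ →L[ℂ] W}
    (h : ∀ (A : Set X) (hA : MeasurableSet A) (hμA : μ A ≠ ∞) (u : V),
      S (indicatorConstLp 1 hA hμA u) = T (indicatorConstLp 1 hA hμA u)) : S = T := by
  refine ContinuousLinearMap.ext_on (dense_span_indicatorConstLp ENNReal.one_ne_top) ?_
  rintro _ ⟨A, hA, hμA, u, rfl⟩
  exact h A hA hμA u

theorem l1Pairing_constTensor (π : Lp ℂ 1 μ →L[ℂ] (E →L[ℂ] E)) (φ : StrongDual ℂ E) (x : E)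
    (f : Lp ℂ 1 μ) :
    l1Pairing π (constTensor μ _ (ProjTensor.tmulL φ x) f) = φ (π f x) := by
  have h : (l1Pairing π).comp (constTensor μ _ (ProjTensor.tmulL φ x)) =
      φ.comp (π.flip x) := by
    refine ContinuousLinearMap.ext_indicatorConstLp fun A hA hμA c => ?_
    have e : indicatorConstLp 1 hA hμA c = c • indicatorConstLp (μ := μ) 1 hA hμA (1 : ℂ) := by
      refine Lp.ext ?_
      filter_upwards [Lp.coeFn_smul c (indicatorConstLp (μ := μ) 1 hA hμA (1 : ℂ)),
        indicatorConstLp_coeFn (p := 1) (hs := hA) (hμs := hμA) (c := (1 : ℂ)),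
        indicatorConstLp_coeFn (p := 1) (hs := hA) (hμs := hμA) (c := c)] with t h1 h2 h3
      rw [h1, h3, Pi.smul_apply, h2]
      by_cases ht : t ∈ A <;> simp [ht]
    rw [e, map_smul, map_smul, ContinuousLinearMap.comp_apply, constTensor_indicator,
      l1Pairing_indicator]
    rfl
  exact congrArg (fun T : Lp ℂ 1 μ →L[ℂ] ℂ => T f) h

/-- The lower bound comes from testing on f ⊗ φ ⊗ x, of norm at most ‖f‖‖φ‖‖x‖. -/
theorem norm_l1Pairing (π : Lp ℂ 1 μ →L[ℂ] (E →L[ℂ] E)) : ‖l1Pairing π‖ = ‖π‖ := by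
  refine le_antisymm ?_ ?_
  · refine ContinuousLinearMap.opNorm_le_bound _ (norm_nonneg π) fun H => ?_
    rw [l1Pairing, ← L1.setToL1_eq_setToL1']
    exact L1.norm_setToL1_le_mul_norm _ (norm_nonneg π) H
  · refine ContinuousLinearMap.opNorm_le_bound _ (norm_nonneg (l1Pairing π)) fun f => ?_
    refine ContinuousLinearMap.opNorm_le_bound _ (by positivity) fun x => ?_
    refine NormedSpace.norm_le_dual_bound ℂ _ (by positivity) fun φ => ?_
    rw [← l1Pairing_constTensor]
    calc _ ≤ ‖l1Pairing π‖ * ‖constTensor μ _ (ProjTensor.tmulL φ x) f‖ :=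
          ContinuousLinearMap.le_opNorm _ _
      _ ≤ ‖l1Pairing π‖ * (‖φ‖ * ‖x‖ * ‖f‖) := by
          gcongr
          exact (norm_constTensor_apply_le _ _).trans
            (by gcongr; exact ProjTensor.norm_tmulL_apply_le _ _)
      _ = _ := by ring

/-- For reflexive `E` every functional on `L¹(X, E^* ⊗̂ E)` comes from `B(L¹(X), B(E))`. -/
theorem exists_l1Pairing_eq (hE : Function.Surjective (NormedSpace.inclusionInDoubleDual ℂ E))
    (ψ : StrongDual ℂ (Lp (ProjTensor (StrongDual ℂ E) E) 1 μ)) :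
    ∃ π : Lp ℂ 1 μ →L[ℂ] (E →L[ℂ] E), l1Pairing π = ψ := by
  obtain ⟨R, hR⟩ := exists_tracePairing_eq hE
  let K : Lp ℂ 1 μ →L[ℂ] StrongDual ℂ (ProjTensor (StrongDual ℂ E) E) :=
    ((ContinuousLinearMap.compL ℂ _ _ ℂ ψ).comp (constTensor μ _)).flip
  have hK : ∀ f u, K f u = ψ (constTensor μ _ u f) := fun f u => rfl
  refine ⟨R.comp K, ContinuousLinearMap.ext_indicatorConstLp fun A hA hμA u => ?_⟩
  rw [l1Pairing_indicator_eq_tracePairing, ContinuousLinearMap.comp_apply, hR, hK,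
    constTensor_indicator]

theorem l1Pairing_add (π ρ : Lp ℂ 1 μ →L[ℂ] (E →L[ℂ] E)) :
    l1Pairing (π + ρ) = l1Pairing π + l1Pairing ρ := by
  refine ContinuousLinearMap.ext_indicatorConstLp fun A hA hμA u => ?_
  simp [l1Pairing_indicator_eq_tracePairing, tracePairing_add]

theorem tracePairing_smul (c : ℂ) (S : E →L[ℂ] E) : tracePairing (c • S) = c • tracePairing S :=
  ProjTensor.ext_tmul fun φ x => by simp [tracePairing_tmul]

theorem l1Pairing_smul (c : ℂ) (π : Lp ℂ 1 μ →L[ℂ] (E →L[ℂ] E)) :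
    l1Pairing (c • π) = c • l1Pairing π := by
  refine ContinuousLinearMap.ext_indicatorConstLp fun A hA hμA u => ?_
  simp [l1Pairing_indicator_eq_tracePairing, tracePairing_smul]

/-! ### The weak-* closure of L^∞(X) ⊗ B(E) and the kernel of Λ. -/

theorem l2Pairing_add (V W : Lp E 2 μ →L[ℂ] Lp E 2 μ) :
    l2Pairing (V + W) = l2Pairing V + l2Pairing W :=
  ProjTensor.ext_tmul fun F G => by
    simp [l2Pairing_tmul_eq_flipPairing]

theorem l2Pairing_smul (c : ℂ) (W : Lp E 2 μ →L[ℂ] Lp E 2 μ) :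
    l2Pairing (c • W) = c • l2Pairing W :=
  ProjTensor.ext_tmul fun F G => by
    simp [l2Pairing_tmul_eq_flipPairing]

variable (μ E) in
/-- The pairing `W ↦ ⟨W, ·⟩` as a linear isometry. -/
def l2PairingLi : (Lp E 2 μ →L[ℂ] Lp E 2 μ) →ₗᵢ[ℂ]
    StrongDual ℂ (ProjTensor (Lp (StrongDual ℂ E) 2 μ) (Lp E 2 μ)) where
  toFun := l2Pairing
  map_add' := l2Pairing_add
  map_smul' := l2Pairing_smul
  norm_map' := norm_l2Pairing

theorem l2Pairing_injective : Function.Injective (l2Pairing (μ := μ) (E := E)) :=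
  (l2PairingLi μ E).injective

/-- `⟨F ⊗ S, τ⟩ = ∫ F(t) ⟨S, Λ(τ)(t)⟩`. -/
theorem l2Pairing_mulTensor (F : Lp ℂ ∞ μ) (S : E →L[ℂ] E)
    (τ : ProjTensor (Lp (StrongDual ℂ E) 2 μ) (Lp E 2 μ)) :
    l2Pairing (mulTensor F S) τ = ∫ t, F t * tracePairing S (LambdaMap μ E τ t) ∂μ := by
  let B : ℂ →L[ℂ] ProjTensor (StrongDual ℂ E) E →L[ℂ] ℂ :=
    (ContinuousLinearMap.id ℂ ℂ).smulRight (tracePairing S)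
  have h : l2Pairing (mulTensor F S) = (B.lpPairing μ ∞ 1 F).comp (LambdaMap μ E) := by
    refine ProjTensor.ext_tmul fun G H => ?_
    rw [l2Pairing_tmul, ContinuousLinearMap.comp_apply,
      ContinuousLinearMap.lpPairing_eq_integral]
    refine integral_congr_ae ?_
    filter_upwards [mulTensor_apply F S H, LambdaMap_tmul μ G H] with t h1 h2
    rw [h1, h2]
    simp [B, tracePairing_tmul]
  rw [h, ContinuousLinearMap.comp_apply, ContinuousLinearMap.lpPairing_eq_integral]
  simp [B]

/-- The preannihilator of `L^∞(X) ⊗ B(E)` is the kernel of `Λ`. -/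
theorem forall_l2Pairing_algTensor_eq_zero_iff
    (hE : Function.Surjective (NormedSpace.inclusionInDoubleDual ℂ E))
    (τ : ProjTensor (Lp (StrongDual ℂ E) 2 μ) (Lp E 2 μ)) :
    (∀ V ∈ algTensor μ E, l2Pairing V τ = 0) ↔ LambdaMap μ E τ = 0 := by
  constructor
  · intro h
    have hint : Integrable (LambdaMap μ E τ) μ := L1.integrable_coeFn _
    obtain ⟨R, hR⟩ := exists_tracePairing_eq hE
    -- An L¹ function has essentially separable range, so it vanishes almost everywhere once each
    -- functional of it does.
    obtain ⟨D, hDs, hD⟩ := (Lp.aestronglyMeasurable (LambdaMap μ E τ)).isSeparable_ae_range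
    rw [Lp.eq_zero_iff_ae_eq_zero]
    refine ae_eq_zero_of_forall_dual_of_isSeparable ℂ hDs (fun κ => ?_) hD
    refine Integrable.ae_eq_zero_of_forall_setIntegral_eq_zero (κ.integrable_comp hint)
      fun A hA hμA => ?_
    have h1 := h (mulTensor (indicatorConstLp ∞ hA hμA.ne 1) (R κ))
      (Submodule.subset_span ⟨_, _, rfl⟩)
    rw [l2Pairing_mulTensor, hR] at h1
    rw [← h1, ← integral_indicator hA]
    refine integral_congr_ae ?_
    filter_upwards [indicatorConstLp_coeFn (p := ∞) (hs := hA) (hμs := hμA.ne) (c := (1 : ℂ))]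
      with t ht
    rw [ht]
    by_cases htA : t ∈ A <;> simp [htA]
  · intro h V hV
    induction hV using Submodule.span_induction with
    | mem V hV =>
      obtain ⟨F, S, rfl⟩ := hV
      rw [l2Pairing_mulTensor, h]
      rw [integral_eq_zero_of_ae]
      filter_upwards [Lp.coeFn_zero (ProjTensor (StrongDual ℂ E) E) 1 μ] with t ht
      rw [ht]; simp
    | zero =>
      have h0 : l2Pairing (0 : Lp E 2 μ →L[ℂ] Lp E 2 μ) = 0 := (l2PairingLi μ E).map_zero
      rw [h0]; rfl
    | add V W _ _ h1 h2 => rw [l2Pairing_add]; simp [h1, h2]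
    | smul c V _ h1 => rw [l2Pairing_smul]; simp [h1]

/-- The closure of a subspace in the topology of pointwise convergence is its double
annihilator. -/
theorem mem_closure_induced_iff {M P : Type*} [AddCommGroup M] [Module ℂ M] [AddCommGroup P]
    [Module ℂ P] (b : M →ₗ[ℂ] P →ₗ[ℂ] ℂ) (p : Submodule ℂ M) (w : M) :
    w ∈ closure[TopologicalSpace.induced (fun m (τ : P) => b m τ) Pi.topologicalSpace] (p : Set M) ↔
      ∀ τ, (∀ v ∈ p, b v τ = 0) → b w τ = 0 := by
  classical
  rw [closure_induced]
  constructor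
  · intro hw τ hτ
    have hcl : IsClosed {x : P → ℂ | x τ = 0} := isClosed_eq (continuous_apply τ) continuous_const
    refine hcl.closure_subset_iff.2 ?_ hw
    rintro _ ⟨v, hv, rfl⟩
    exact hτ v hv
  · intro h
    rw [mem_closure_iff_nhds]
    intro U hU
    rw [nhds_pi, Filter.mem_pi'] at hU
    obtain ⟨I, t, ht, htU⟩ := hU
    -- A basic neighbourhood sees only finitely many τ. If `ev w` were outside the image of `p`, a
    -- separating functional on `I → ℂ` would be pairing with one combination of these τ that
    -- annihilates `p` but not `w`.
    let ev : M →ₗ[ℂ] (I → ℂ) := LinearMap.pi fun τ : I => b.flip τ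
    have hmem : ev w ∈ p.map ev := by
      by_contra hnot
      obtain ⟨f, hf, hfp⟩ := Submodule.exists_le_ker_of_notMem hnot
      have hfe : ∀ m, f (ev m) = b m (∑ τ : I, f (Pi.single τ 1) • (τ : P)) := fun m => by
        rw [LinearMap.pi_apply_eq_sum_univ f (ev m), map_sum]
        refine Finset.sum_congr rfl fun τ _ => ?_
        rw [map_smul, smul_eq_mul, smul_eq_mul, mul_comm]
        congr 2
        ext σ
        simp [Pi.single_apply, eq_comm]
      refine hf ?_
      rw [hfe]
      refine h _ fun v hv => ?_
      rw [← hfe]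
      exact hfp (Submodule.mem_map_of_mem hv)
    obtain ⟨v, hv, hvw⟩ := hmem
    refine ⟨_, htU fun τ hτ => ?_, ⟨v, hv, rfl⟩⟩
    have h1 : b v τ = b w τ := congrFun hvw ⟨τ, hτ⟩
    simp only
    rw [h1]
    exact mem_of_mem_nhds (ht τ)

theorem mem_vnTensor_iff (hE : Function.Surjective (NormedSpace.inclusionInDoubleDual ℂ E))
    (W : Lp E 2 μ →L[ℂ] Lp E 2 μ) :
    W ∈ vnTensor μ E ↔ ∀ τ, LambdaMap μ E τ = 0 → l2Pairing W τ = 0 := by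
  simp only [← forall_l2Pairing_algTensor_eq_zero_iff hE]
  exact mem_closure_induced_iff ((ContinuousLinearMap.coeLM ℂ).comp (l2PairingLi μ E).toLinearMap)
    (algTensor μ E) W

theorem norm_eq_of_l2Pairing_eq {π : Lp ℂ 1 μ →L[ℂ] (E →L[ℂ] E)}
    {W : Lp E 2 μ →L[ℂ] Lp E 2 μ} (h : l2Pairing W = (l1Pairing π).comp (LambdaMap μ E)) :
    ‖W‖ = ‖π‖ :=
  calc ‖W‖ = ‖l2Pairing W‖ := (norm_l2Pairing W).symm
    _ = ‖(l1Pairing π).comp (LambdaMap μ E)‖ := by rw [h]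
    _ = ‖l1Pairing π‖ := ContinuousLinearMap.norm_comp_eq_of_metric_surjection _
      norm_LambdaMap_le exists_LambdaMap_eq _
    _ = ‖π‖ := norm_l1Pairing π

/-- An operator on `L²(X, E)` that annihilates the kernel of `Λ` comes from `B(L¹(X), B(E))`. -/
theorem exists_l2Pairing_eq_of_forall
    (hE : Function.Surjective (NormedSpace.inclusionInDoubleDual ℂ E))
    {W : Lp E 2 μ →L[ℂ] Lp E 2 μ} (h : ∀ τ, LambdaMap μ E τ = 0 → l2Pairing W τ = 0) :
    ∃ π : Lp ℂ 1 μ →L[ℂ] (E →L[ℂ] E), l2Pairing W = (l1Pairing π).comp (LambdaMap μ E) := by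
  obtain ⟨ψ, hψ⟩ := (LambdaMap μ E).exists_comp_eq_of_ker_le
    (fun H => (exists_LambdaMap_eq H 1 one_pos).imp fun _ => And.left) (l2Pairing W) h
  obtain ⟨π, rfl⟩ := exists_l1Pairing_eq hE ψ
  exact ⟨π, hψ⟩

end Dual

end

theorem mainTheorem6 {X : Type*} [MeasurableSpace X] (μ : Measure X)
    {E : Type*} [NormedAddCommGroup E] [NormedSpace ℂ E] [CompleteSpace E]
    (hE : Function.Surjective (NormedSpace.inclusionInDoubleDual ℂ E)) :
    LambdaMap μ E '' Metric.ball 0 1 = Metric.ball 0 1 ∧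
    ∃ Φ : (Lp ℂ 1 μ →L[ℂ] (E →L[ℂ] E)) →ₗᵢ[ℂ] (Lp E 2 μ →L[ℂ] Lp E 2 μ),
      (∀ (π : Lp ℂ 1 μ →L[ℂ] (E →L[ℂ] E)) (W : Lp E 2 μ →L[ℂ] Lp E 2 μ),
        Φ π = W ↔ l2Pairing W = (l1Pairing π).comp (LambdaMap μ E)) ∧
      Set.range Φ = vnTensor μ E := by
  refine ⟨LambdaMap_image_ball, ?_⟩
  choose Φ hΦ using fun π : Lp ℂ 1 μ →L[ℂ] (E →L[ℂ] E) => exists_l2Pairing_eq hE π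
  let Φₗ : (Lp ℂ 1 μ →L[ℂ] (E →L[ℂ] E)) →ₗ[ℂ] (Lp E 2 μ →L[ℂ] Lp E 2 μ) :=
    { toFun := Φ
      -- `Φ` was chosen pointwise; its linearity follows from uniqueness of the representing
      -- operator.
      map_add' := fun π ρ => l2Pairing_injective (by
        rw [l2Pairing_add, hΦ, hΦ, hΦ, l1Pairing_add, ContinuousLinearMap.add_comp])
      map_smul' := fun c π => l2Pairing_injective (by
        rw [RingHom.id_apply, l2Pairing_smul, hΦ, hΦ, l1Pairing_smul,
          ContinuousLinearMap.smul_comp]) }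
  refine ⟨⟨Φₗ, fun π => norm_eq_of_l2Pairing_eq (hΦ π)⟩,
    fun π W => ⟨?_, fun h => l2Pairing_injective ((hΦ π).trans h.symm)⟩, ?_⟩
  · rintro rfl
    exact hΦ π
  · ext W
    rw [mem_vnTensor_iff hE]
    constructor
    · rintro ⟨π, rfl⟩ τ hτ
      change l2Pairing (Φ π) τ = 0
      rw [hΦ, ContinuousLinearMap.comp_apply, hτ, map_zero]
    · intro h
      obtain ⟨π, hπ⟩ := exists_l2Pairing_eq_of_forall hE h
      exact ⟨π, l2Pairing_injective ((hΦ π).trans hπ.symm)⟩
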